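/- For $k\ge 1$ distinct centers $\mu_1,\dots,\mu_k\in[-B,B]^d$ ($d\ge 1$, $B>0$), consider the following randomized procedure. Start with a single node that contains all the centers. Repeatedly and independently draw a direction $r$ uniformly from $\{1,\dots,d\}$ and a threshold $z$ uniformly from $[-B,B]$. Every current leaf in which the cut $\{x_r=z\}$ separates two of the centers in that leaf is split into two children, one for $\{x_r<z\}$ and one for $\{x_r\ge z\}$, each containing the centers on its side; the other leaves are left unchanged. Stop when every leaf contains exactly one center. A point $x\in\mathbb R^d$ is assigned to the center $\mu_s$ in the leaf that $x$ reaches; write $s=s(x)$. There is an absolute constant $C>0$ such that the following holds for all such $d$, $k$, $B$, $\mu_1,\dots,\mu_k$. Put $F_k=\max(1,\log k\cdot\log\log k)$ (with $F_1=1$) and $D_d=\max(1,d\log^2 d)$, where $\log$ is the natural logarithm. (i) Almost surely the procedure stops, and the resulting threshold tree has exactly $k$ leaves, each containing exactly one center. (ii) For every point $x\in\mathbb R^d$, $$\mathbb E\,\|x-\mu_{s(x)}\|_1\le C\,F_k\cdot\min_i\|x-\mu_i\|_1\qquad\text{and}\qquad \mathbb E\,\|x-\mu_{s(x)}\|_1\le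 C\,D_d\cdot\min_i\|x-\mu_i\|_1 .$$ (iii) For every finite dataset $X$ of points in $\mathbb R^d$ (repetitions allowed), let $\mathrm{OPT}$ be the infimum of $\sum_{x\in X}\min_i\|x-\nu_i\|_1$ over all $\nu_1,\dots,\nu_k\in\mathbb R^d$. If $A\in\mathbb R$ and $\sum_{x\in X}\min_i\|x-\mu_i\|_1\le A\cdot\mathrm{OPT}$, then $$\mathbb E\sum_{x\in X}\|x-\mu_{s(x)}\|_1\le C\,A\,\min(F_k,D_d)\cdot\mathrm{OPT}.$$ -/

import Mathlib

open MeasureTheory ProbabilityTheory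

/-- The `ℓ₁` distance on `ℝ^d`. -/
def l1dist {d : ℕ} (x y : Fin d → ℝ) : ℝ := ∑ r, |x r - y r|

/-- The `ℓ₁` distance from a point to the closest of the centers `μ 0, …, μ (k-1)`. -/
noncomputable def distToCenters {d k : ℕ} (μ : Fin k → Fin d → ℝ) (x : Fin d → ℝ) : ℝ :=
  ⨅ i, l1dist x (μ i)

/-- The `k`-medians cost of the centers `μ` on the dataset `X`. -/
noncomputable def mediansCost {d k n : ℕ} (μ : Fin k → Fin d → ℝ) (X : Fin n → Fin d → ℝ) : ℝ :=
  ∑ a, distToCenters μ (X a)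

/-- The optimal (unrestricted) `k`-medians cost of the dataset `X`. -/
noncomputable def mediansOPT {d n : ℕ} (k : ℕ) (X : Fin n → Fin d → ℝ) : ℝ :=
  ⨅ ν : Fin k → Fin d → ℝ, mediansCost ν X

/-- Threshold trees. The internal node `node r z L R` sends the points with `x r < z` to `L`, and
those with `z ≤ x r` to `R`. Each leaf stores the set of (indices of) centers that it contains. -/
inductive ThresholdTree (d k : ℕ) : Type
  | leaf (M : Finset (Fin k)) : ThresholdTree d k
  | node (r : Fin d) (z : ℝ) (L R : ThresholdTree d k) : ThresholdTree d k

namespace ThresholdTree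

variable {d k : ℕ}

/-- The leaves (center sets) of a tree, from left to right. -/
def leaves : ThresholdTree d k → List (Finset (Fin k))
  | leaf M => [M]
  | node _ _ L R => L.leaves ++ R.leaves

/-- The center set of the leaf that the point `x` reaches. -/
noncomputable def leafOf (x : Fin d → ℝ) : ThresholdTree d k → Finset (Fin k)
  | leaf M => M
  | node r z L R => if x r < z then L.leafOf x else R.leafOf x

open Classical in
/-- Apply the cut `{x_r = z}`, where `c = (r, z)`, to a tree: every leaf in which the cut separates
two of the centers is split in two; every other leaf is left as it is. -/
noncomputable def applyCut (μ : Fin k → Fin d → ℝ) (c : Fin d × ℝ) :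
    ThresholdTree d k → ThresholdTree d k
  | leaf M =>
      if (∃ i ∈ M, μ i c.1 < c.2) ∧ (∃ j ∈ M, c.2 ≤ μ j c.1) then
        node c.1 c.2 (leaf (M.filter fun i => μ i c.1 < c.2))
          (leaf (M.filter fun i => c.2 ≤ μ i c.1))
      else leaf M
  | node r z L R => node r z (L.applyCut μ c) (R.applyCut μ c)

/-- The centers are separated: each leaf contains exactly one center. -/
def Separated (t : ThresholdTree d k) : Prop := ∀ M ∈ t.leaves, M.card = 1

end ThresholdTree

/-- The tree after the first `n` cuts of a sequence of cuts; at the start, a single leaf contains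
all the centers. -/
noncomputable def treeAfter {d k : ℕ} (μ : Fin k → Fin d → ℝ) (c : ℕ → Fin d × ℝ) :
    ℕ → ThresholdTree d k
  | 0 => ThresholdTree.leaf Finset.univ
  | n + 1 => (treeAfter μ c n).applyCut μ (c n)

/-- The procedure run on a sequence of cuts stops as soon as the centers are separated. -/
def Terminates {d k : ℕ} (μ : Fin k → Fin d → ℝ) (c : ℕ → Fin d × ℝ) : Prop :=
  ∃ n, (treeAfter μ c n).Separated

/-- The tree at the moment the procedure stops (meaningful if it terminates). -/
noncomputable def outputTree {d k : ℕ} (μ : Fin k → Fin d → ℝ) (c : ℕ → Fin d × ℝ) :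
    ThresholdTree d k :=
  treeAfter μ c (sInf {n | (treeAfter μ c n).Separated})

/-- The index `s` of the center to which the output tree assigns `x`: the unique center in the leaf
that `x` reaches (arbitrary if the procedure does not terminate). -/
noncomputable def assigned {d k : ℕ} [NeZero k] (μ : Fin k → Fin d → ℝ) (c : ℕ → Fin d × ℝ)
    (x : Fin d → ℝ) : Fin k :=
  Classical.epsilon fun i => i ∈ (outputTree μ c).leafOf x

/-- The cost of the clustering of the dataset `X` given by the output tree. -/
noncomputable def treeCost {d k n : ℕ} [NeZero k] (μ : Fin k → Fin d → ℝ) (c : ℕ → Fin d × ℝ)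
    (X : Fin n → Fin d → ℝ) : ℝ :=
  ∑ a, l1dist (X a) (μ (assigned μ c (X a)))

/-- The law of a random cut `(r, z)`: a uniform direction `r` and, independently, a threshold `z`
uniform on `[-B, B]`. -/
noncomputable def cutLaw (d : ℕ) (B : ℝ) : Measure (Fin d × ℝ) :=
  (uniformOn (Set.univ : Set (Fin d))).prod (cond volume (Set.Icc (-B) B))

/-- `cut 0, cut 1, …` are independent uniformly random axis-parallel cuts of `[-B, B]^d`. -/
structure IsUniformCuts {Ω : Type*} [MeasurableSpace Ω] {d : ℕ} (B : ℝ) (P : Measure Ω)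
    (cut : ℕ → Ω → Fin d × ℝ) : Prop where
  measurable : ∀ n, Measurable (cut n)
  indep : iIndepFun cut P
  law : ∀ n, P.map (cut n) = cutLaw d B

/-- The factor `log k · log log k`, as an `O(·)`: at least `1`, so that it also makes sense for
`k ≤ 2`. -/
noncomputable def kFactor (k : ℕ) : ℝ :=
  max 1 (Real.log k * Real.log (Real.log k))

/-- The factor `d · log² d`, as an `O(·)`: at least `1`, so that it also makes sense for
`d = 1`. -/
noncomputable def dFactor (d : ℕ) : ℝ :=
  max 1 (d * Real.log d ^ 2)

/-!
Fix a point `x`. A cut acts on the center set `M` of the leaf of `x` only through the set `S` of the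
centers that it separates from `x`: `M` becomes `M \ S` if this is nonempty, and stays as it is
otherwise (`survivors`, `leafAfter_succ`). So this leaf is a Markov chain on sets of centers, and a
random cut separates the center `i` from `x` with a probability `rate i` that is an affine function
of the distance of `i` from `x` (`exists_l1dist_eq`). It remains to bound the expected rate of the
last survivor by `α` times the smallest rate, for a suitable `α`. The smallest rate `minRate M` can
only grow along the chain, so its expectation after `n` steps is what has to be bounded
(`transition_pow_minRate_le`).

The proof is by induction on the number of centers. Let `a` be the center of smallest rate `δ`, and
decompose according to the step at which `a` is lost, by a cut `S ∋ a`; such cuts have total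
probability `δ`. If at that time all centers have rate below `4 δ`, the final rate is below `4 δ`.
Otherwise there are two bounds for the contribution of the pair of a step `i` and a cut `S`. As
cuts commute (`survivors_sdiff`), the cut `S` may be moved to the start, and the induction
hypothesis gives `α m`, where `m` is the smallest rate outside `S`. On the other hand, the final
rate is at most the largest rate in the leaf after `i` steps, which is at least `m` and at least
`4 δ`; let `m` now stand for the larger of the two. While `a` is present, the probability that a
center of rate at least `w` is left after `i` steps is at most `K exp (-i w / 4)` (`HasTail`). So the contribution is `O(log K / i)`, and it decays exponentially
in `i` once `i` exceeds a multiple of `log K / m`. The sum over `i` of the smaller of the two bounds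
is `O(log K · log α)`: only the range of `i` between `log K / (α m)` and `log K / m` matters, and
there `∑ 1 / i` is about `log α`. So `α` may be any number with `C (1 + log K · log α) ≤ α`, and
`α = O(log K · log log K)` will do (`recursive_inequality`).

The tail bound holds for `K = k`, by the union bound over the centers (`hasTail_card`). It also
holds for `K = 64 ^ d`: up to rounding, a center of large rate determines, for each of the `2 d`
signed coordinate directions, a threshold up to which no cut has been made, and there are at most `64 ^ d`
cases (`hasTail_of_chains`, `hasTail_cutOffLaw`). These give the factors `O(log k · log log k)` and
`O(d · log d)`.

The procedure terminates almost surely because every pair of centers is eventually separated by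
some cut (`ae_terminates`). The statement on datasets follows by adding up the bounds for points.
-/

/-! ### The Markov chain of the leaf of a point -/

section Chain

variable {ι : Type*} [DecidableEq ι]

/-- The effect of a cut on the center set `M` of the leaf reached by a fixed point, where `S` is the
set of the centers that the cut separates from the point. If `M ⊆ S`, the cut does not separate two
centers of the leaf, and the leaf stays as it is. -/
def survivors (M S : Finset ι) : Finset ι := if (M \ S).Nonempty then M \ S else M

lemma survivors_subset (M S : Finset ι) : survivors M S ⊆ M := by
  unfold survivors; split_ifs <;> simp

/-- A cut `S` may be applied before a cut `U` instead of after it, as long as it still leaves some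
center. -/
lemma survivors_sdiff {M S U : Finset ι} (h : (survivors M U \ S).Nonempty) :
    survivors M U \ S = survivors (M \ S) U := by
  have e : (M \ U) \ S = (M \ S) \ U := by ext; simp; tauto
  unfold survivors at *
  by_cases h1 : (M \ U).Nonempty
  · rw [if_pos h1] at h ⊢
    rw [if_pos (e ▸ h), e]
  · rw [if_neg h1] at h ⊢
    have : (M \ S) \ U = ∅ := by
      rw [← e, Finset.not_nonempty_iff_eq_empty.1 h1]; simp
    simp [this]

lemma notMem_survivors {M S : Finset ι} {a : ι} (ha : a ∈ M) :
    a ∉ survivors M S ↔ a ∈ S ∧ (M \ S).Nonempty := by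
  unfold survivors
  split_ifs with h <;> simp [ha, h]

variable [Fintype ι]

/-- The transition operator of the Markov chain `M ↦ survivors M S`, where `S` is drawn with
probability `ν S`: the value at `M` is the expectation of `f` after one step from `M`. -/
noncomputable def transition (ν : Finset ι → ℝ) : Module.End ℝ (Finset ι → ℝ) where
  toFun f M := ∑ S, ν S * f (survivors M S)
  map_add' f g := by ext M; simp [mul_add, Finset.sum_add_distrib]
  map_smul' c f := by ext M; simp [Finset.mul_sum, mul_left_comm]

/-- The probability that a random cut separates the center `i` from the point. -/
noncomputable def rate (ν : Finset ι → ℝ) (i : ι) : ℝ := ∑ S with i ∈ S, ν S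

/-- The smallest rate of a center in `M` (`0` for `M = ∅`). -/
noncomputable def minRate (ν : Finset ι → ℝ) (M : Finset ι) : ℝ :=
  if h : M.Nonempty then M.inf' h (rate ν) else 0

/-- The largest rate of a center in `M` (`0` for `M = ∅`). -/
noncomputable def maxRate (ν : Finset ι → ℝ) (M : Finset ι) : ℝ :=
  if h : M.Nonempty then M.sup' h (rate ν) else 0

variable {ν : Finset ι → ℝ}

lemma transition_apply (f : Finset ι → ℝ) (M : Finset ι) :
    transition ν f M = ∑ S, ν S * f (survivors M S) := rfl

lemma transition_pow_succ (n : ℕ) (f : Finset ι → ℝ) (M : Finset ι) :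
    (transition ν ^ (n + 1)) f M = ∑ S, ν S * (transition ν ^ n) f (survivors M S) := by
  rw [pow_succ', Module.End.mul_apply, transition_apply]

lemma minRate_le {M : Finset ι} {i : ι} (hi : i ∈ M) : minRate ν M ≤ rate ν i := by
  rw [minRate, dif_pos ⟨i, hi⟩]; exact Finset.inf'_le _ hi

lemma exists_minRate {M : Finset ι} (h : M.Nonempty) : ∃ i ∈ M, minRate ν M = rate ν i := by
  rw [minRate, dif_pos h]; exact Finset.exists_mem_eq_inf' h _

lemma le_maxRate {M : Finset ι} {i : ι} (hi : i ∈ M) : rate ν i ≤ maxRate ν M := by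
  rw [maxRate, dif_pos ⟨i, hi⟩]; exact Finset.le_sup' _ hi

lemma exists_maxRate {M : Finset ι} (h : M.Nonempty) : ∃ i ∈ M, maxRate ν M = rate ν i := by
  rw [maxRate, dif_pos h]; exact Finset.exists_mem_eq_sup' h _

lemma minRate_anti {M M' : Finset ι} (h : M' ⊆ M) (h' : M'.Nonempty) :
    minRate ν M ≤ minRate ν M' := by
  obtain ⟨i, hi, e⟩ := exists_minRate (ν := ν) h'
  rw [e]; exact minRate_le (h hi)

lemma maxRate_mono {M M' : Finset ι} (h : M' ⊆ M) (h' : M'.Nonempty) :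
    maxRate ν M' ≤ maxRate ν M := by
  obtain ⟨i, hi, e⟩ := exists_maxRate (ν := ν) h'
  rw [e]; exact le_maxRate (h hi)

lemma minRate_le_maxRate (M : Finset ι) : minRate ν M ≤ maxRate ν M := by
  rcases M.eq_empty_or_nonempty with rfl | ⟨i, hi⟩
  · simp [minRate, maxRate]
  · exact (minRate_le hi).trans (le_maxRate hi)

section Nonneg

variable (hν : ∀ S, 0 ≤ ν S)
include hν

/-- Since a leaf only loses centers, only the values of the functions on subsets of `M` matter. -/
lemma transition_pow_mono {f g : Finset ι → ℝ} (n : ℕ) {M : Finset ι}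
    (h : ∀ M' ⊆ M, f M' ≤ g M') : (transition ν ^ n) f M ≤ (transition ν ^ n) g M := by
  induction n generalizing M with
  | zero => simpa using h M subset_rfl
  | succ n ih =>
    simp only [transition_pow_succ]
    exact Finset.sum_le_sum fun S _ => mul_le_mul_of_nonneg_left
      (ih fun M' hM' => h M' (hM'.trans (survivors_subset M S))) (hν S)

lemma transition_pow_nonneg {f : Finset ι → ℝ} (n : ℕ) {M : Finset ι}
    (h : ∀ M' ⊆ M, 0 ≤ f M') : 0 ≤ (transition ν ^ n) f M := by
  simpa using transition_pow_mono hν (f := 0) n h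

lemma rate_nonneg (i : ι) : 0 ≤ rate ν i := Finset.sum_nonneg fun S _ => hν S

lemma le_rate {S : Finset ι} {i : ι} (h : i ∈ S) : ν S ≤ rate ν i :=
  Finset.single_le_sum (f := ν) (fun S _ => hν S) (by simpa using h)

lemma minRate_nonneg (M : Finset ι) : 0 ≤ minRate ν M := by
  rcases M.eq_empty_or_nonempty with rfl | h
  · simp [minRate]
  · obtain ⟨i, -, e⟩ := exists_minRate (ν := ν) h
    rw [e]; exact rate_nonneg hν i

lemma maxRate_nonneg (M : Finset ι) : 0 ≤ maxRate ν M :=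
  (minRate_nonneg hν M).trans (minRate_le_maxRate M)

variable (h1 : ∑ S, ν S = 1)
include h1

omit hν in
lemma transition_pow_const (c : ℝ) (n : ℕ) (M : Finset ι) :
    (transition ν ^ n) (fun _ => c) M = c := by
  induction n generalizing M with
  | zero => simp
  | succ n ih => simp [transition_pow_succ, ih, ← Finset.sum_mul, h1]

lemma rate_le_one (i : ι) : rate ν i ≤ 1 := by
  rw [← h1]
  exact Finset.sum_le_sum_of_subset_of_nonneg (Finset.subset_univ _) fun S _ _ => hν S

lemma maxRate_le_one (M : Finset ι) : maxRate ν M ≤ 1 := by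
  rcases M.eq_empty_or_nonempty with rfl | h
  · simp [maxRate]
  · obtain ⟨i, -, e⟩ := exists_maxRate (ν := ν) h
    rw [e]; exact rate_le_one hν h1 i

end Nonneg

/-- The decomposition of an expectation after `n` steps by the step at which the center `a` is
lost. -/
lemma transition_pow_eq_sum_loss (g : Finset ι → ℝ) (n : ℕ) {M : Finset ι} {a : ι} (ha : a ∈ M) :
    (transition ν ^ n) g M =
      (transition ν ^ n) (fun M' => if a ∈ M' then g M' else 0) M +
      ∑ i ∈ Finset.range n, ∑ S with a ∈ S, ν S *
        (transition ν ^ i) (fun M' => if a ∈ M' ∧ (M' \ S).Nonempty then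
          (transition ν ^ (n - 1 - i)) g (M' \ S) else 0) M := by
  have key : ∀ m : ℕ, m ≤ n → (transition ν ^ n) g M =
      (transition ν ^ m) (fun M' => if a ∈ M' then (transition ν ^ (n - m)) g M' else 0) M +
      ∑ i ∈ Finset.range m, ∑ S with a ∈ S, ν S *
        (transition ν ^ i) (fun M' => if a ∈ M' ∧ (M' \ S).Nonempty then
          (transition ν ^ (n - 1 - i)) g (M' \ S) else 0) M := by
    intro m
    induction m with
    | zero => intro; simp [ha]
    | succ m ih =>
      intro hm
      rw [ih (by omega), Finset.sum_range_succ, add_comm (∑ i ∈ Finset.range m, _), ← add_assoc]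
      congr 1
      have hn : n - m = (n - (m + 1)) + 1 := by omega
      have hn' : n - 1 - m = n - (m + 1) := by omega
      rw [hn, hn']
      set h := (transition ν ^ (n - (m + 1))) g with hh
      have e : (fun M' => if a ∈ M' then (transition ν ^ (n - (m + 1) + 1)) g M' else 0) =
          transition ν (fun M' => if a ∈ M' then h M' else 0) +
          ∑ S with a ∈ S, ν S •
            (fun M' : Finset ι => if a ∈ M' ∧ (M' \ S).Nonempty then h (M' \ S) else 0) := by
        ext M'
        simp only [transition_pow_succ, ← hh, Pi.add_apply, transition_apply, Finset.sum_apply,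
          Pi.smul_apply, smul_eq_mul]
        rw [Finset.sum_filter, ← Finset.sum_add_distrib]
        by_cases haM : a ∈ M'
        · rw [if_pos haM]
          refine Finset.sum_congr rfl fun S _ => ?_
          by_cases hS : a ∈ survivors M' S
          · have := (notMem_survivors (S := S) haM).not.1 (not_not.2 hS)
            rw [if_pos hS]
            split_ifs <;> simp_all
          · obtain ⟨h2, h3⟩ := (notMem_survivors (S := S) haM).1 hS
            rw [if_neg hS, if_pos h2, if_pos ⟨haM, h3⟩]
            simp [survivors, h3]
        · rw [if_neg haM]
          symm
          refine Finset.sum_eq_zero fun S _ => ?_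
          have : a ∉ survivors M' S := fun h => haM (survivors_subset _ _ h)
          simp [this, haM]
      rw [e, map_add, map_sum, pow_succ, Module.End.mul_apply]
      simp only [Pi.add_apply, Finset.sum_apply, map_smul, Pi.smul_apply, smul_eq_mul]
  simpa using key n le_rfl

/-- Applying the cut `S` after `i` steps, on the event that it then leaves some center, gives at
most the expectation obtained by applying it at the start. -/
lemma transition_pow_sdiff_le (hν : ∀ S, 0 ≤ ν S) {h : Finset ι → ℝ} (hh : ∀ M, 0 ≤ h M)
    (S : Finset ι) (i : ℕ) (M : Finset ι) :
    (transition ν ^ i) (fun M' => if (M' \ S).Nonempty then h (M' \ S) else 0) M ≤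
      (transition ν ^ i) h (M \ S) := by
  induction i generalizing M with
  | zero => simp only [pow_zero, Module.End.one_apply]; split_ifs <;> simp [hh]
  | succ i ih =>
    simp only [transition_pow_succ]
    refine Finset.sum_le_sum fun U _ => mul_le_mul_of_nonneg_left ?_ (hν U)
    by_cases hU : (survivors M U \ S).Nonempty
    · rw [← survivors_sdiff hU]; exact ih _
    · -- Once every remaining center lies in `S`, this stays so.
      have h0 : (transition ν ^ i) (fun M' => if (M' \ S).Nonempty then h (M' \ S) else 0)
          (survivors M U) ≤ (transition ν ^ i) 0 (survivors M U) := by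
        refine transition_pow_mono hν i fun M' hM' => ?_
        rw [if_neg fun h' => hU (h'.mono (Finset.sdiff_subset_sdiff hM' subset_rfl))]
        simp
      refine h0.trans ?_
      simpa using transition_pow_nonneg hν i fun M' _ => hh M'

/-- The tail hypothesis: the probability that after `i` steps the center `a` is still present,
together with a center of rate at least `w`, decays exponentially in `i * w`, up to a factor `K`. -/
def HasTail (ν : Finset ι → ℝ) (K : ℝ) : Prop :=
  ∀ (a : ι) (w : ℝ) (i : ℕ) (M : Finset ι), 4 * rate ν a ≤ w → 0 ≤ w →
    (transition ν ^ i) (fun M' => if a ∈ M' ∧ w ≤ maxRate ν M' then 1 else 0) M ≤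
      K * Real.exp (-(i * w / 4))

end Chain

/-! ### The recursive bound for the expected rate -/

section Bound

variable {ι : Type*} [DecidableEq ι] [Fintype ι] {ν : Finset ι → ℝ}

/-- A layer-cake bound with layers `u, 2u, 3u, …`. -/
lemma le_two_mul_sum_layers {W u : ℝ} (hu : 0 < u) (hW : u ≤ W) {N : ℕ} (hN : W ≤ N * u) :
    W ≤ 2 * u * ∑ l ∈ Finset.range N, if (l + 1) * u ≤ W then (1 : ℝ) else 0 := by
  have h1 : 1 ≤ W / u := (one_le_div hu).2 hW
  set m := ⌊W / u⌋₊ with hm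
  have hm1 : 1 ≤ m := Nat.one_le_floor_iff _ |>.2 h1
  have hmW : (m : ℝ) ≤ W / u := Nat.floor_le (by linarith)
  have hWm : W / u < m + 1 := Nat.lt_floor_add_one _
  have hmN : m ≤ N := by
    have : (m : ℝ) ≤ N := hmW.trans ((div_le_iff₀ hu).2 hN)
    exact_mod_cast this
  have hs : (m : ℝ) ≤ ∑ l ∈ Finset.range N, if (l + 1) * u ≤ W then (1 : ℝ) else 0 := by
    calc (m : ℝ) = ∑ l ∈ Finset.range m, (1 : ℝ) := by simp
      _ ≤ ∑ l ∈ Finset.range m, if (l + 1) * u ≤ W then (1 : ℝ) else 0 := by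
        refine Finset.sum_le_sum fun l hl => ?_
        have : (l : ℝ) + 1 ≤ m := by exact_mod_cast Finset.mem_range.1 hl
        rw [if_pos]
        rw [← le_div_iff₀ hu]; linarith
      _ ≤ _ := Finset.sum_le_sum_of_subset_of_nonneg (by simpa using hmN)
        fun _ _ _ => by split_ifs <;> norm_num
  have hm1' : (1 : ℝ) ≤ m := by exact_mod_cast hm1
  have : W < (m + 1) * u := (div_lt_iff₀ hu).1 hWm
  nlinarith

/-- The truncated expectation of `maxRate`, on the event that `a` is present, after at least
`8 L / u` steps. -/
lemma truncated_maxRate_le (hν : ∀ S, 0 ≤ ν S) (h1 : ∑ S, ν S = 1) {K L : ℝ} (hL : 1 ≤ L)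
    (hK : K ≤ Real.exp L) (ht : HasTail ν K) {a : ι} {u : ℝ} (hu : 0 < u) (hau : 4 * rate ν a ≤ u)
    (i : ℕ) (hi : 8 * L ≤ i * u) (M : Finset ι) :
    (transition ν ^ i) (fun M' => if a ∈ M' ∧ u ≤ maxRate ν M' then maxRate ν M' else 0) M ≤
      4 * u * Real.exp (-(i * u / 8)) := by
  obtain ⟨N, hN⟩ := exists_nat_ge (1 / u)
  have hN' : 1 ≤ N * u := (div_le_iff₀ hu).1 hN
  have step1 : (transition ν ^ i)
      (fun M' => if a ∈ M' ∧ u ≤ maxRate ν M' then maxRate ν M' else 0) M ≤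
      (transition ν ^ i) ((2 * u) • ∑ l ∈ Finset.range N, fun M' =>
        if a ∈ M' ∧ ((l : ℝ) + 1) * u ≤ maxRate ν M' then (1 : ℝ) else 0) M := by
    refine transition_pow_mono hν i fun M' _ => ?_
    simp only [Pi.smul_apply, Finset.sum_apply, smul_eq_mul]
    split_ifs with h
    · have := le_two_mul_sum_layers hu h.2 ((maxRate_le_one hν h1 M').trans hN')
      simpa [h.1] using this
    · have : 0 ≤ ∑ l ∈ Finset.range N,
          if a ∈ M' ∧ ((l : ℝ) + 1) * u ≤ maxRate ν M' then (1 : ℝ) else 0 :=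
        Finset.sum_nonneg fun _ _ => by split_ifs <;> norm_num
      positivity
  refine step1.trans ?_
  rw [map_smul, map_sum]
  simp only [Pi.smul_apply, Finset.sum_apply, smul_eq_mul]
  set q := Real.exp (-(i * u / 8)) with hq
  have hq0 : 0 < q := Real.exp_pos _
  have hq1 : q ≤ 1 / 2 := by
    have h2 : q ≤ Real.exp (-1) := Real.exp_le_exp.2 (by linarith)
    have := Real.exp_neg_one_lt_half
    linarith
  have step2 : ∀ l ∈ Finset.range N, (transition ν ^ i) (fun M' =>
      if a ∈ M' ∧ ((l : ℝ) + 1) * u ≤ maxRate ν M' then (1 : ℝ) else 0) M ≤ q * (1 / 2) ^ l := by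
    intro l _
    have hl : (0 : ℝ) ≤ l := l.cast_nonneg
    refine (ht a ((l + 1) * u) i M (by nlinarith) (by positivity)).trans ?_
    calc K * Real.exp (-(i * ((l + 1) * u) / 4))
        ≤ Real.exp L * Real.exp (-(i * ((l + 1) * u) / 4)) := by gcongr
      _ ≤ Real.exp ((l + 1 : ℕ) * (-(i * u / 8))) := by
        rw [← Real.exp_add]
        refine Real.exp_le_exp.2 ?_
        push_cast
        nlinarith
      _ = q * q ^ l := by rw [Real.exp_nat_mul, ← hq, pow_succ, mul_comm]
      _ ≤ q * (1 / 2) ^ l := by gcongr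
  have step3 : ∑ l ∈ Finset.range N, q * (1 / 2 : ℝ) ^ l ≤ q * 2 := by
    rw [← Finset.mul_sum]
    gcongr
    exact sum_geometric_two_le N
  calc 2 * u * _ ≤ 2 * u * (q * 2) := by
        gcongr
        exact (Finset.sum_le_sum step2).trans step3
    _ = 4 * u * q := by ring

/-- The truncated expectation of `maxRate` after `i` steps is `O(L / i)`. -/
lemma truncated_maxRate_le_div (hν : ∀ S, 0 ≤ ν S) (h1 : ∑ S, ν S = 1) {K L : ℝ} (hL : 1 ≤ L)
    (hK : K ≤ Real.exp L) (ht : HasTail ν K) {a : ι} {u : ℝ} (hau : 4 * rate ν a ≤ u)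
    (i : ℕ) (hi0 : 0 < i) (hi : i * u ≤ 8 * L) (M : Finset ι) :
    (transition ν ^ i) (fun M' => if a ∈ M' ∧ u ≤ maxRate ν M' then maxRate ν M' else 0) M ≤
      40 * L / i := by
  have hi' : (0 : ℝ) < i := by exact_mod_cast hi0
  set v := 8 * L / i with hv
  have hv0 : 0 < v := by positivity
  have huv : u ≤ v := by rw [hv, le_div_iff₀ hi']; linarith
  have hiv : i * v = 8 * L := by rw [hv]; field_simp
  have step1 : (transition ν ^ i)
      (fun M' => if a ∈ M' ∧ u ≤ maxRate ν M' then maxRate ν M' else 0) M ≤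
      (transition ν ^ i) ((fun _ => v) +
        fun M' => if a ∈ M' ∧ v ≤ maxRate ν M' then maxRate ν M' else 0) M := by
    refine transition_pow_mono hν i fun M' _ => ?_
    simp only [Pi.add_apply]
    by_cases ha : a ∈ M' <;> by_cases h2 : v ≤ maxRate ν M'
    · simp [ha, h2, huv.trans h2, hv0.le]
    · simp only [ha, h2, true_and, if_false, add_zero]
      split_ifs <;> linarith
    · simp [ha, hv0.le]
    · simp [ha, hv0.le]
  have step2 := truncated_maxRate_le hν h1 hL hK ht hv0 (hau.trans huv) i hiv.ge M
  have hexp : Real.exp (-(i * v / 8)) ≤ 1 := Real.exp_le_one_iff.2 (by rw [hiv]; linarith)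
  rw [map_add, Pi.add_apply, transition_pow_const h1] at step1
  calc _ ≤ v + 4 * v * 1 := step1.trans (by gcongr; exact step2.trans (by gcongr))
    _ = 40 * L / i := by rw [hv]; ring

/-- Up to the time `R`, the smaller of `α / R` and `1 / i` sums to `O(log α)`. -/
lemma sum_min_div_le {R α : ℝ} (hR : 0 < R) (hα : 0 < α) (N : ℕ) (hN : N ≤ R) :
    ∑ i ∈ Finset.range N, min (α / R) (1 / ((i : ℝ) + 1)) ≤ 2 * Real.log (1 + α) := by
  set c := R / α with hc
  have hc0 : 0 < c := by positivity
  have term : ∀ i : ℕ, min (α / R) (1 / ((i : ℝ) + 1)) ≤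
      2 * (Real.log (c + (i + 1 : ℕ)) - Real.log (c + i)) := by
    intro i
    have hi : (0 : ℝ) < i + 1 := by positivity
    have hci : 0 < c + (i + 1) := by positivity
    have hci' : 0 < c + i := by positivity
    have e1 : min (α / R) (1 / ((i : ℝ) + 1)) ≤ 2 * (1 / (c + (i + 1))) := by
      rcases le_total c (i + 1) with h | h
      · refine (min_le_right _ _).trans ?_
        rw [mul_one_div, div_le_div_iff₀ hi hci]; linarith
      · refine (min_le_left _ _).trans ?_
        have : α / R = 1 / c := by rw [hc]; field_simp
        rw [this, mul_one_div, div_le_div_iff₀ hc0 hci]; linarith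
    have e2 : 1 / (c + (i + 1)) ≤ Real.log (c + (i + 1 : ℕ)) - Real.log (c + i) := by
      push_cast
      have := Real.one_sub_inv_le_log_of_pos (x := (c + (i + 1)) / (c + i)) (by positivity)
      rw [Real.log_div hci.ne' hci'.ne'] at this
      refine le_trans (le_of_eq ?_) this
      field_simp
      ring
    linarith
  refine (Finset.sum_le_sum fun i _ => term i).trans ?_
  rw [← Finset.mul_sum, Finset.sum_range_sub (fun i : ℕ => Real.log (c + i))]
  gcongr
  rw [Nat.cast_zero, add_zero, ← Real.log_div (by positivity) hc0.ne']
  refine Real.log_le_log (by positivity) ?_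
  rw [div_le_iff₀ hc0, hc]
  have : (1 + α) * (R / α) = R / α + R := by field_simp
  linarith

/-- The sum over time of the bounds for the contribution of a cut that leaves only centers of rate
at least `m`: the bound `b 0 ≤ 1`, the a-priori bound `α m`, the bound `40 L / i` before the
time `8 L / m`, and an exponentially small bound from then on. -/
lemma sum_contribution_le {α L m : ℝ} (hα : 0 < α) (hL : 1 ≤ L) (hm : 0 < m)
    {b : ℕ → ℝ} (h0 : b 0 ≤ 1) (hb : ∀ i, b i ≤ α * m)
    (hb1 : ∀ i : ℕ, 0 < i → i * m ≤ 8 * L → b i ≤ 40 * L / i)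
    (hb2 : ∀ i : ℕ, 8 * L ≤ i * m → b i ≤ 4 * m * Real.exp (-(i * m / 8))) (n : ℕ) :
    ∑ i ∈ Finset.range n, b i ≤ 33 + 80 * L * Real.log (1 + α) := by
  have hlog : 0 ≤ Real.log (1 + α) := Real.log_nonneg (by linarith)
  rcases n with _ | n
  · simp; positivity
  set R := 8 * L / m with hR
  have hR0 : 0 < R := by positivity
  have hRm : R * m = 8 * L := by rw [hR]; field_simp
  set N := ⌊R⌋₊ with hN
  have hNR : (N : ℝ) ≤ R := Nat.floor_le hR0.le
  set q := Real.exp (-(m / 8)) with hq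
  have hq0 : 0 < q := Real.exp_pos _
  have hq1 : q < 1 := by rw [hq, Real.exp_lt_one_iff]; linarith
  have hterm : ∀ i : ℕ, b (i + 1) ≤
      40 * L * (if i < N then min (α / R) (1 / ((i : ℝ) + 1)) else 0) + 4 * m * (q * q ^ i) := by
    intro i
    have hi : (0 : ℝ) < i + 1 := by positivity
    by_cases h : i < N
    · have h' : ((i : ℝ) + 1) * m ≤ 8 * L := by
        rw [← hRm]; gcongr
        have : (i : ℝ) + 1 ≤ N := by exact_mod_cast h
        linarith
      rw [if_pos h]
      have hp : 0 ≤ 4 * m * (q * q ^ i) := by positivity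
      refine le_add_of_le_of_nonneg ?_ hp
      rw [mul_min_of_nonneg _ _ (by positivity : 0 ≤ 40 * L)]
      refine le_min ((hb _).trans ?_) ?_
      · rw [hR]
        have : 40 * L * (α / (8 * L / m)) = 5 * (α * m) := by field_simp; ring
        rw [this]
        nlinarith [mul_pos hα hm]
      · have := hb1 (i + 1) (by omega) (by push_cast; exact h')
        push_cast at this
        rwa [mul_one_div]
    · rw [if_neg h, mul_zero, zero_add]
      have h' : 8 * L ≤ ((i : ℝ) + 1) * m := by
        rw [← hRm]; gcongr
        have h2 := Nat.lt_floor_add_one R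
        have h3 : (N : ℝ) ≤ i := by exact_mod_cast not_lt.1 h
        linarith
      refine (hb2 (i + 1) (by push_cast; exact h')).trans (le_of_eq ?_)
      rw [← pow_succ', hq, ← Real.exp_nat_mul]
      congr 2
      push_cast; ring
  rw [Finset.sum_range_succ']
  have hs := Finset.sum_le_sum fun i (_ : i ∈ Finset.range n) => hterm i
  rw [Finset.sum_add_distrib, ← Finset.mul_sum, ← Finset.mul_sum, ← Finset.mul_sum] at hs
  have s1 : ∑ i ∈ Finset.range n, (if i < N then min (α / R) (1 / ((i : ℝ) + 1)) else 0) ≤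
      2 * Real.log (1 + α) := by
    refine le_trans ?_ (sum_min_div_le hR0 hα N hNR)
    rw [← Finset.sum_filter]
    refine Finset.sum_le_sum_of_subset_of_nonneg (fun i hi => ?_) fun i _ _ => by positivity
    simpa using (Finset.mem_filter.1 hi).2
  have s2 : 4 * m * (q * ∑ i ∈ Finset.range n, q ^ i) ≤ 32 := by
    have hg : ∑ i ∈ Finset.range n, q ^ i ≤ (1 - q)⁻¹ := by
      rw [← tsum_geometric_of_lt_one hq0.le hq1]
      exact (summable_geometric_of_lt_one hq0.le hq1).sum_le_tsum _ fun _ _ => by positivity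
    have hq2 : m / 8 * q ≤ 1 - q := by
      have h := Real.add_one_le_exp (m / 8)
      have e : Real.exp (m / 8) * q = 1 := by rw [hq, ← Real.exp_add]; simp
      nlinarith
    have h1q : 0 < 1 - q := by linarith
    calc 4 * m * (q * ∑ i ∈ Finset.range n, q ^ i) ≤ 4 * m * (q * (1 - q)⁻¹) := by gcongr
      _ = 32 * (m / 8 * q) / (1 - q) := by field_simp; ring
      _ ≤ 32 := by rw [div_le_iff₀ h1q]; linarith
  have s1' := mul_le_mul_of_nonneg_left s1 (by positivity : 0 ≤ 40 * L)
  linarith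

/-- If `α` satisfies the recursive inequality `38 + 80 L log (1 + α) ≤ α`, then the expected rate of
the center that is finally reached is at most `α` times the smallest rate. -/
theorem transition_pow_minRate_le (hν : ∀ S, 0 ≤ ν S) (h1 : ∑ S, ν S = 1) {K L α : ℝ} (hL : 1 ≤ L)
    (hK : K ≤ Real.exp L) (ht : HasTail ν K) (hα : 38 + 80 * L * Real.log (1 + α) ≤ α)
    (hα0 : 0 < α) (n : ℕ) (M : Finset ι) (hM : M.Nonempty) :
    (transition ν ^ n) (minRate ν) M ≤ α * minRate ν M := by
  induction hc : M.card using Nat.strong_induction_on generalizing M n with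
  | _ c ih =>
  subst hc
  obtain ⟨a, ha, hmin⟩ := exists_minRate (ν := ν) hM
  set δ := rate ν a with hδ
  have hδ0 : 0 ≤ δ := rate_nonneg hν a
  set g := minRate ν with hg
  have hg0 : ∀ M, 0 ≤ g M := minRate_nonneg hν
  have hlog : 0 ≤ Real.log (1 + α) := Real.log_nonneg (by linarith)
  -- The smallest rate is always at most the largest rate at an earlier time.
  have hgW : ∀ (j : ℕ) (M' : Finset ι), M'.Nonempty →
      (transition ν ^ j) g M' ≤ maxRate ν M' := by
    intro j M' hM'
    rw [← transition_pow_const h1 (maxRate ν M') j M']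
    refine transition_pow_mono hν j fun M'' h => ?_
    rcases M''.eq_empty_or_nonempty with rfl | h'
    · simpa [hg, minRate] using maxRate_nonneg hν M'
    · exact (minRate_le_maxRate M'').trans (maxRate_mono h h')
  have hTg0 : ∀ (j : ℕ) (M' : Finset ι), 0 ≤ (transition ν ^ j) g M' :=
    fun j M' => transition_pow_nonneg hν j fun M'' _ => hg0 M''
  rw [transition_pow_eq_sum_loss g n ha]
  have hfirst : (transition ν ^ n) (fun M' => if a ∈ M' then g M' else 0) M ≤ δ := by
    rw [← transition_pow_const h1 δ n M]
    refine transition_pow_mono hν n fun M' _ => ?_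
    split_ifs with h
    · exact minRate_le h
    · exact hδ0
  -- The total probability of the loss of `a` is at most `1`.
  have hloss : ∑ i ∈ Finset.range n, ∑ S with a ∈ S, ν S * (transition ν ^ i)
      (fun M' => if a ∈ M' ∧ (M' \ S).Nonempty then (1 : ℝ) else 0) M ≤ 1 := by
    have h := transition_pow_eq_sum_loss (ν := ν) (fun _ => (1 : ℝ)) n ha
    simp only [transition_pow_const h1] at h
    have h' : 0 ≤ (transition ν ^ n) (fun M' => if a ∈ M' then (1 : ℝ) else 0) M :=
      transition_pow_nonneg hν n fun M' _ => by split_ifs <;> norm_num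
    linarith
  let b : Finset ι → ℕ → ℝ := fun S i => (transition ν ^ i)
    (fun M' => if a ∈ M' ∧ (M' \ S).Nonempty ∧ 4 * δ ≤ maxRate ν M' then
      (transition ν ^ (n - 1 - i)) g (M' \ S) else 0) M
  have hsplit : ∀ S (i : ℕ), (transition ν ^ i) (fun M' => if a ∈ M' ∧ (M' \ S).Nonempty then
      (transition ν ^ (n - 1 - i)) g (M' \ S) else 0) M ≤ 4 * δ * (transition ν ^ i)
      (fun M' => if a ∈ M' ∧ (M' \ S).Nonempty then (1 : ℝ) else 0) M + b S i := by
    intro S i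
    have : 4 * δ * (transition ν ^ i)
      (fun M' => if a ∈ M' ∧ (M' \ S).Nonempty then (1 : ℝ) else 0) M + b S i =
      (transition ν ^ i) ((4 * δ) • (fun M' : Finset ι => if a ∈ M' ∧ (M' \ S).Nonempty then
        (1 : ℝ) else 0) + fun M' => if a ∈ M' ∧ (M' \ S).Nonempty ∧ 4 * δ ≤ maxRate ν M' then
      (transition ν ^ (n - 1 - i)) g (M' \ S) else 0) M := by
      rw [map_add, map_smul]; rfl
    rw [this]
    refine transition_pow_mono hν i fun M' _ => ?_
    simp only [Pi.add_apply, Pi.smul_apply, smul_eq_mul]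
    by_cases h : a ∈ M' ∧ (M' \ S).Nonempty
    · rw [if_pos h, if_pos h]
      by_cases h2 : 4 * δ ≤ maxRate ν M'
      · rw [if_pos ⟨h.1, h.2, h2⟩]; linarith
      · rw [if_neg fun h' => h2 h'.2.2]
        have := (hgW (n - 1 - i) _ h.2).trans (maxRate_mono Finset.sdiff_subset h.2)
        linarith
    · rw [if_neg h, if_neg h, if_neg fun h' => h ⟨h'.1, h'.2.1⟩]; simp
  have hbsum : ∀ S, a ∈ S → ν S * ∑ i ∈ Finset.range n, b S i ≤
      ν S * (33 + 80 * L * Real.log (1 + α)) := by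
    intro S haS
    rcases (hν S).eq_or_lt with h0 | hpos
    · simp [← h0]
    refine mul_le_mul_of_nonneg_left ?_ (hν S)
    have hδpos : 0 < δ := hpos.trans_le (le_rate hν haS)
    by_cases hne : (M \ S).Nonempty
    · set m := max (g (M \ S)) (4 * δ) with hm
      have hm0 : 0 < m := lt_max_of_lt_right (by linarith)
      have ham : 4 * rate ν a ≤ m := le_max_right _ _
      have hbW : ∀ i, b S i ≤ (transition ν ^ i)
          (fun M' => if a ∈ M' ∧ m ≤ maxRate ν M' then maxRate ν M' else 0) M := by
        intro i
        refine transition_pow_mono hν i fun M' hM' => ?_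
        by_cases h : a ∈ M' ∧ (M' \ S).Nonempty ∧ 4 * δ ≤ maxRate ν M'
        · have hW := maxRate_mono (ν := ν) (M := M') Finset.sdiff_subset h.2.1
          rw [if_pos h, if_pos]
          · exact (hgW _ _ h.2.1).trans hW
          · refine ⟨h.1, max_le ?_ h.2.2⟩
            exact (minRate_anti (Finset.sdiff_subset_sdiff hM' subset_rfl) h.2.1).trans
              ((minRate_le_maxRate _).trans hW)
        · rw [if_neg h]
          split_ifs
          · exact maxRate_nonneg hν M'
          · exact le_rfl
      refine sum_contribution_le hα0 hL hm0 ?_ ?_ ?_ ?_ n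
      · refine (hbW 0).trans ?_
        simp only [pow_zero, Module.End.one_apply]
        split_ifs
        · exact maxRate_le_one hν h1 M
        · exact zero_le_one
      · intro i
        have e1 : b S i ≤ (transition ν ^ i) (fun M' => if (M' \ S).Nonempty then
            (transition ν ^ (n - 1 - i)) g (M' \ S) else 0) M := by
          refine transition_pow_mono hν i fun M' _ => ?_
          by_cases h : (M' \ S).Nonempty
          · rw [if_pos h]
            split_ifs
            · exact le_rfl
            · exact hTg0 _ _
          · rw [if_neg h, if_neg fun h' => h h'.2.1]
        have e2 := transition_pow_sdiff_le hν (h := (transition ν ^ (n - 1 - i)) g)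
          (hTg0 _) S i M
        rw [← Module.End.mul_apply, ← pow_add] at e2
        have hlt : (M \ S).card < M.card := Finset.card_lt_card
          ⟨Finset.sdiff_subset, fun h => (Finset.mem_sdiff.1 (h ha)).2 haS⟩
        have e3 := ih _ hlt (i + (n - 1 - i)) (M \ S) hne rfl
        have e4 : α * g (M \ S) ≤ α * m := by gcongr; exact le_max_left _ _
        linarith
      · intro i hi0 hi
        exact (hbW i).trans (truncated_maxRate_le_div hν h1 hL hK ht ham i hi0 hi M)
      · intro i hi
        exact (hbW i).trans (truncated_maxRate_le hν h1 hL hK ht hm0 ham i hi M)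
    · have hb0 : ∀ i ∈ Finset.range n, b S i ≤ 0 := by
        intro i _
        have : b S i ≤ (transition ν ^ i) (fun _ => 0) M := by
          refine transition_pow_mono hν i fun M' hM' => ?_
          rw [if_neg]
          exact fun h => hne (h.2.1.mono (Finset.sdiff_subset_sdiff hM' subset_rfl))
        rwa [transition_pow_const h1] at this
      have := Finset.sum_nonpos hb0
      have hp : 0 ≤ 80 * L * Real.log (1 + α) := by positivity
      linarith
  have hmain : ∑ i ∈ Finset.range n, ∑ S with a ∈ S, ν S * (transition ν ^ i)
      (fun M' => if a ∈ M' ∧ (M' \ S).Nonempty then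
        (transition ν ^ (n - 1 - i)) g (M' \ S) else 0) M ≤
      4 * δ + δ * (33 + 80 * L * Real.log (1 + α)) := by
    calc _ ≤ ∑ i ∈ Finset.range n, ∑ S with a ∈ S, (4 * δ * (ν S * (transition ν ^ i)
          (fun M' => if a ∈ M' ∧ (M' \ S).Nonempty then (1 : ℝ) else 0) M) + ν S * b S i) := by
          refine Finset.sum_le_sum fun i _ => Finset.sum_le_sum fun S _ => ?_
          have := mul_le_mul_of_nonneg_left (hsplit S i) (hν S)
          linarith
      _ = 4 * δ * (∑ i ∈ Finset.range n, ∑ S with a ∈ S, ν S * (transition ν ^ i)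
          (fun M' => if a ∈ M' ∧ (M' \ S).Nonempty then (1 : ℝ) else 0) M) +
          ∑ S with a ∈ S, ν S * ∑ i ∈ Finset.range n, b S i := by
          simp only [Finset.sum_add_distrib, Finset.mul_sum]
          congr 1
          exact Finset.sum_comm
      _ ≤ 4 * δ * 1 + ∑ S with a ∈ S, ν S * (33 + 80 * L * Real.log (1 + α)) := by
          refine add_le_add (by gcongr) (Finset.sum_le_sum fun S hS => ?_)
          exact hbsum S (Finset.mem_filter.1 hS).2
      _ = _ := by rw [← Finset.sum_mul, mul_one]; rfl
  rw [hmin]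
  nlinarith

/-- The recursive inequality of `transition_pow_minRate_le` has a solution of order `L log L`. -/
lemma recursive_inequality {L : ℝ} (hL : 1 ≤ L) :
    38 + 80 * L * Real.log (1 + 1000 * (L * (1 + Real.log L))) ≤ 1000 * (L * (1 + Real.log L)) := by
  have hl0 : 0 ≤ Real.log L := Real.log_nonneg hL
  have hl1 : 1 + Real.log L ≤ L := by linarith [Real.log_le_sub_one_of_pos (by linarith : 0 < L)]
  have h1 : 1 + 1000 * (L * (1 + Real.log L)) ≤ 1024 * L ^ 2 := by nlinarith
  have h2 : Real.log (1 + 1000 * (L * (1 + Real.log L))) ≤ 7 + 2 * Real.log L := by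
    refine (Real.log_le_log (by positivity) h1).trans ?_
    rw [Real.log_mul (by norm_num) (by positivity), Real.log_pow,
      show (1024 : ℝ) = 2 ^ 10 by norm_num, Real.log_pow]
    have := Real.log_two_lt_d9
    push_cast
    linarith
  have h3 : 80 * L * Real.log (1 + 1000 * (L * (1 + Real.log L))) ≤
      80 * L * (7 + 2 * Real.log L) := by gcongr
  nlinarith [mul_nonneg (by linarith : 0 ≤ L) hl0]

end Bound

/-! ### Tail bounds -/

section Tail

variable {ι : Type*} [DecidableEq ι] [Fintype ι] {ν : Finset ι → ℝ}

/-- If the property `p` is never regained and is lost with probability at least `θ` in each step,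
it persists for `i` steps with probability at most `exp (-i θ)`. -/
lemma transition_pow_indicator_le (hν : ∀ S, 0 ≤ ν S) (h1 : ∑ S, ν S = 1) {p : Finset ι → Prop}
    [DecidablePred p] {θ : ℝ} (hp : ∀ M S, p (survivors M S) → p M)
    (hθ : ∀ M, p M → θ ≤ ∑ S with ¬ p (survivors M S), ν S) (i : ℕ) (M : Finset ι) :
    (transition ν ^ i) (fun M' => if p M' then 1 else 0) M ≤ Real.exp (-(i * θ)) := by
  suffices h : (transition ν ^ i) (fun M' => if p M' then 1 else 0) M ≤
      Real.exp (-θ) ^ i * if p M then 1 else 0 by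
    refine h.trans ?_
    rw [← Real.exp_nat_mul, mul_neg]
    split_ifs
    · simp
    · simpa using (Real.exp_pos _).le
  induction i generalizing M with
  | zero => simp
  | succ i ih =>
    rw [transition_pow_succ]
    refine (Finset.sum_le_sum fun S _ => mul_le_mul_of_nonneg_left (ih _) (hν S)).trans ?_
    have hq : 0 ≤ Real.exp (-θ) ^ i := by positivity
    by_cases hM : p M
    · have e : ∑ S, ν S * (Real.exp (-θ) ^ i * if p (survivors M S) then 1 else 0) =
          Real.exp (-θ) ^ i * ∑ S with p (survivors M S), ν S := by
        rw [Finset.sum_filter, Finset.mul_sum]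
        exact Finset.sum_congr rfl fun S _ => by split_ifs <;> ring
      have hs := Finset.sum_filter_add_sum_filter_not Finset.univ (fun S => p (survivors M S)) ν
      have := Real.add_one_le_exp (-θ)
      have := hθ M hM
      rw [e, if_pos hM, pow_succ, mul_one]
      exact mul_le_mul_of_nonneg_left (by linarith) hq
    · have : ∀ S, ¬ p (survivors M S) := fun S h => hM (hp M S h)
      simp [this, hM]

/-- The tail bound by the number of centers: a center of rate at least `w` is separated from `a` by
a random cut that does not separate `a` from the point, with probability at least `3 w / 4`. -/
lemma hasTail_card (hν : ∀ S, 0 ≤ ν S) (h1 : ∑ S, ν S = 1) : HasTail ν (Fintype.card ι) := by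
  classical
  intro a w i M ha hw
  have h : (transition ν ^ i) (fun M' => if a ∈ M' ∧ w ≤ maxRate ν M' then 1 else 0) M ≤
      (transition ν ^ i) (∑ j with w ≤ rate ν j,
        fun M' : Finset ι => if a ∈ M' ∧ j ∈ M' then (1 : ℝ) else 0) M := by
    refine transition_pow_mono hν i fun M' _ => ?_
    rw [Finset.sum_apply]
    have hn : ∀ j ∈ Finset.univ.filter fun j => w ≤ rate ν j,
        (0 : ℝ) ≤ if a ∈ M' ∧ j ∈ M' then 1 else 0 := fun j _ => by split_ifs <;> norm_num
    split_ifs with hM'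
    · obtain ⟨j, hj, e⟩ := exists_maxRate (ν := ν) ⟨a, hM'.1⟩
      have := Finset.single_le_sum hn (a := j) (by simpa using e ▸ hM'.2)
      simpa [hM'.1, hj] using this
    · exact Finset.sum_nonneg hn
  refine h.trans ?_
  rw [map_sum, Finset.sum_apply]
  calc _ ≤ ∑ j with w ≤ rate ν j, Real.exp (-(i * w / 4)) := by
        refine Finset.sum_le_sum fun j hj => ?_
        have hj' : w ≤ rate ν j := (Finset.mem_filter.1 hj).2
        refine (transition_pow_indicator_le hν h1 (p := fun M' => a ∈ M' ∧ j ∈ M') (θ := w / 4)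
          ?_ ?_ i M).trans (le_of_eq (by rw [mul_div_assoc]))
        · exact fun M S h => ⟨survivors_subset _ _ h.1, survivors_subset _ _ h.2⟩
        · rintro M ⟨haM, hjM⟩
          have h2 : rate ν j ≤
              rate ν a + ∑ S with ¬ (a ∈ survivors M S ∧ j ∈ survivors M S), ν S := by
            unfold rate
            rw [← Finset.sum_filter_add_sum_filter_not (Finset.univ.filter fun S => j ∈ S)
              (fun S => a ∈ S)]
            refine add_le_add ?_ ?_ <;>
              refine Finset.sum_le_sum_of_subset_of_nonneg (fun S hS => ?_) fun S _ _ => hν S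
            · simp at hS ⊢; exact hS.2
            · simp only [Finset.mem_filter, Finset.mem_univ, true_and] at hS ⊢
              rintro ⟨-, h⟩
              have : (M \ S).Nonempty := ⟨a, by simp [haM, hS.2]⟩
              exact (notMem_survivors hjM).2 ⟨hS.1, this⟩ h
          linarith
    _ ≤ Fintype.card ι * Real.exp (-(i * w / 4)) := by
        rw [Finset.sum_const, nsmul_eq_mul]
        gcongr
        exact Finset.card_le_univ _

/-- The size of the net of directions: there are at most `8 ^ N` vectors of `N` natural numbers with
sum between `N` and `2 N`. -/
lemma card_net_le {R : Type*} [Fintype R] [DecidableEq R] :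
    ((Finset.univ.filter fun c : R → Fin (2 * Fintype.card R + 1) =>
      Fintype.card R ≤ ∑ q, (c q : ℕ) ∧ ∑ q, (c q : ℕ) ≤ 2 * Fintype.card R).card : ℝ) ≤
      8 ^ Fintype.card R := by
  set N := Fintype.card R
  rw [Finset.card_eq_sum_ones, Nat.cast_sum]
  calc _ ≤ ∑ c : R → Fin (2 * N + 1), (2 : ℝ) ^ (2 * N) * ∏ q, (1 / 2 : ℝ) ^ (c q : ℕ) := by
        rw [Finset.sum_filter]
        refine Finset.sum_le_sum fun c _ => ?_
        split_ifs with h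
        · rw [Finset.prod_pow_eq_pow_sum, one_div, inv_pow]
          have : (2 : ℝ) ^ (∑ q, (c q : ℕ)) ≤ 2 ^ (2 * N) := pow_le_pow_right₀ (by norm_num) h.2
          simpa [div_eq_mul_inv] using (one_le_div (by positivity)).2 this
        · positivity
    _ = (2 : ℝ) ^ (2 * N) * ∏ q : R, ∑ x : Fin (2 * N + 1), (1 / 2 : ℝ) ^ (x : ℕ) := by
        rw [← Finset.mul_sum, Finset.prod_univ_sum, Fintype.piFinset_univ]
    _ ≤ (2 : ℝ) ^ (2 * N) * ∏ q : R, 2 := by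
        gcongr with q
        rw [Fin.sum_univ_eq_sum_range (fun x => (1 / 2 : ℝ) ^ x)]
        exact sum_geometric_two_le _
    _ = 8 ^ N := by
        rw [Finset.prod_const, Finset.card_univ, pow_mul, ← mul_pow]; norm_num

/-- The tail bound by the number of directions, for cuts of which those in a direction `q : R`
(drawn with weights `κ q`) are nested. If a center of rate at least `w` is left, then in every
direction the cuts up to some threshold have been missed, and the probabilities of these cuts add
up to a multiple of `w`. Rounding the thresholds leaves at most `8 ^ |R|` cases. -/
lemma hasTail_of_chains {R : Type*} [Fintype R] [DecidableEq R] [Nonempty R]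
    {κ : R → Finset ι → ℝ}
    (hκ : ∀ q S, 0 ≤ κ q S) (hνκ : ∀ S, ν S = ∑ q, κ q S) (h1 : ∑ S, ν S = 1)
    (hchain : ∀ q S S', κ q S ≠ 0 → κ q S' ≠ 0 → S ⊆ S' ∨ S' ⊆ S) :
    HasTail ν (8 ^ Fintype.card R) := by
  classical
  intro a w i M₀ ha hw
  have hν : ∀ S, 0 ≤ ν S := fun S => by rw [hνκ]; exact Finset.sum_nonneg fun q _ => hκ q S
  set N := Fintype.card R with hN
  have hN0 : 0 < (N : ℝ) := by exact_mod_cast Fintype.card_pos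
  rcases hw.eq_or_lt with rfl | hw
  · have : (transition ν ^ i) (fun M' => if a ∈ M' ∧ 0 ≤ maxRate ν M' then 1 else 0) M₀ ≤
        (transition ν ^ i) (fun _ => 1) M₀ :=
      transition_pow_mono hν i fun M' _ => by split_ifs <;> norm_num
    rw [transition_pow_const h1] at this
    have h8 : (1 : ℝ) ≤ 8 ^ N := one_le_pow₀ (by norm_num)
    simpa using this.trans h8
  set δ := rate ν a with hδ
  set y : R → ι → ℝ := fun q j => ∑ S with j ∈ S, κ q S with hy
  have hrate : ∀ j, rate ν j = ∑ q, y q j := by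
    intro j
    simp only [hy, rate, hνκ]
    exact Finset.sum_comm
  set η := (w - δ) / (2 * N) with hη
  have hwδ : 0 < w - δ := by linarith
  have hη0 : 0 < η := by positivity
  have hηN : η * (2 * N) = w - δ := by rw [hη]; field_simp
  let C : Finset (R → Fin (2 * N + 1)) := Finset.univ.filter fun c =>
      N ≤ ∑ q, (c q : ℕ) ∧ ∑ q, (c q : ℕ) ≤ 2 * N
  let p : (R → Fin (2 * N + 1)) → Finset ι → Prop := fun c M =>
    a ∈ M ∧ ∀ q, (c q : ℕ) ≠ 0 → ∃ j ∈ M, y q a + η * (c q : ℕ) ≤ y q j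
  have hcover : (transition ν ^ i) (fun M' => if a ∈ M' ∧ w ≤ maxRate ν M' then 1 else 0) M₀ ≤
      (transition ν ^ i) (∑ c ∈ C, fun M' => if p c M' then (1 : ℝ) else 0) M₀ := by
    refine transition_pow_mono hν i fun M' _ => ?_
    rw [Finset.sum_apply]
    have hn : ∀ c ∈ C, (0 : ℝ) ≤ if p c M' then 1 else 0 :=
      fun j _ => by split_ifs <;> norm_num
    split_ifs with hM'
    · obtain ⟨j, hj, e⟩ := exists_maxRate (ν := ν) ⟨a, hM'.1⟩
      -- Scaling the differences makes their sum exactly `w - δ`, which bounds the rounded ones.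
      set v : R → ℝ := fun q => max 0 (y q j - y q a) with hv
      have hv0 : ∀ q, 0 ≤ v q := fun q => le_max_left _ _
      have hV : w - δ ≤ ∑ q, v q := by
        calc w - δ ≤ rate ν j - rate ν a := by rw [← e]; linarith [hM'.2]
          _ = ∑ q, (y q j - y q a) := by rw [hrate, hrate, Finset.sum_sub_distrib]
          _ ≤ _ := Finset.sum_le_sum fun q _ => le_max_right _ _
      have hV0 : 0 < ∑ q, v q := hwδ.trans_le hV
      set β := (w - δ) / ∑ q, v q with hβ
      have hβ0 : 0 < β := by positivity
      have hβ1 : β ≤ 1 := (div_le_one hV0).2 hV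
      set t : R → ℝ := fun q => β * v q / η with ht
      have ht0 : ∀ q, 0 ≤ t q := fun q => div_nonneg (mul_nonneg hβ0.le (hv0 q)) hη0.le
      have htsum : ∑ q, t q = 2 * N := by
        simp only [ht]
        rw [← Finset.sum_div, ← Finset.mul_sum, hβ, div_mul_cancel₀ _ hV0.ne', ← hηN]
        field_simp
      have hle : ∑ q, ⌊t q⌋₊ ≤ 2 * N := by
        have : ((∑ q, ⌊t q⌋₊ : ℕ) : ℝ) ≤ (2 * N : ℕ) := by
          push_cast
          rw [← htsum]
          exact Finset.sum_le_sum fun q _ => Nat.floor_le (ht0 q)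
        exact_mod_cast this
      have hge : N ≤ ∑ q, ⌊t q⌋₊ := by
        have : (N : ℝ) ≤ ((∑ q, ⌊t q⌋₊ : ℕ) : ℝ) := by
          push_cast
          calc (N : ℝ) = ∑ q, (t q - 1) := by
                rw [Finset.sum_sub_distrib, htsum]; simp [← hN]; ring
            _ ≤ _ := Finset.sum_le_sum fun q _ => (Nat.sub_one_lt_floor _).le
        exact_mod_cast this
      have hlt : ∀ q, ⌊t q⌋₊ < 2 * N + 1 := fun q => Nat.lt_succ_of_le <|
        (Finset.single_le_sum (f := fun q => ⌊t q⌋₊) (fun _ _ => Nat.zero_le _)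
          (Finset.mem_univ q)).trans hle
      let c : R → Fin (2 * N + 1) := fun q => ⟨⌊t q⌋₊, hlt q⟩
      have hc : c ∈ C := Finset.mem_filter.2 ⟨Finset.mem_univ _, hge, hle⟩
      have hpc : p c M' := by
        refine ⟨hM'.1, fun q hq => ⟨j, hj, ?_⟩⟩
        have h2 : η * ⌊t q⌋₊ ≤ β * v q := by
          have := Nat.floor_le (ht0 q)
          rw [mul_comm, ← le_div_iff₀ hη0]; exact this
        have h3 : (1 : ℝ) ≤ ⌊t q⌋₊ := by exact_mod_cast Nat.one_le_iff_ne_zero.2 hq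
        have h4 : β * v q ≤ v q := mul_le_of_le_one_left (hv0 q) hβ1
        have h5 : 0 < v q := by nlinarith
        have h6 : v q = y q j - y q a := by
          rcases max_choice 0 (y q j - y q a) with h | h
          · simp only [hv] at h5; rw [h] at h5; exact absurd h5 (lt_irrefl _)
          · exact h
        change y q a + η * (⌊t q⌋₊ : ℕ) ≤ y q j
        linarith
      have := Finset.single_le_sum hn hc
      simpa [hpc] using this
    · exact Finset.sum_nonneg hn
  -- As the cuts of a direction are nested, the center beyond a threshold that lies in the fewest
  -- of them is cut only together with all the others.
  have hkill : ∀ (q : R) (x : ℝ) (M : Finset ι), (∃ j ∈ M, y q a + x ≤ y q j) →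
      x ≤ ∑ S with a ∉ S ∧ ∀ j ∈ M, y q a + x ≤ y q j → j ∈ S, κ q S := by
    intro q x M hM
    let F : ι → Finset (Finset ι) := fun j => Finset.univ.filter fun S => κ q S ≠ 0 ∧ j ∈ S
    obtain ⟨j₀, hj₀, hminj⟩ := Finset.exists_min_image (M.filter fun j => y q a + x ≤ y q j)
      (fun j => (F j).card) (by obtain ⟨j, hj, h⟩ := hM; exact ⟨j, by simp [hj, h]⟩)
    have hsub : ∀ j ∈ M, y q a + x ≤ y q j → F j₀ ⊆ F j := by
      intro j hj hjx
      by_contra hns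
      obtain ⟨S, hS, hSj⟩ := Finset.not_subset.1 hns
      have hsub' : F j ⊆ F j₀ := by
        intro S' hS'
        simp only [F, Finset.mem_filter, Finset.mem_univ, true_and] at hS hSj hS' ⊢
        refine ⟨hS'.1, ?_⟩
        rcases hchain q S S' hS.1 hS'.1 with h | h
        · exact h hS.2
        · exact absurd ⟨hS.1, h hS'.2⟩ hSj
      exact hns (Finset.eq_of_subset_of_card_le hsub' (hminj j (by simp [hj, hjx]))).ge
    have hj₀' := (Finset.mem_filter.1 hj₀).2
    have h2 : y q j₀ ≤ y q a +
        ∑ S with a ∉ S ∧ ∀ j ∈ M, y q a + x ≤ y q j → j ∈ S, κ q S := by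
      have e : y q j₀ = ∑ S ∈ F j₀, κ q S := by
        refine (Finset.sum_subset (fun S hS => ?_) fun S hS hS' => ?_).symm
        · simp only [F, Finset.mem_filter] at hS; simp [hS.2.2]
        · by_contra h; exact hS' (by simp_all [F])
      rw [e, ← Finset.sum_filter_add_sum_filter_not (F j₀) (fun S => a ∈ S)]
      refine add_le_add ?_ ?_ <;>
        refine Finset.sum_le_sum_of_subset_of_nonneg (fun S hS => ?_) fun S _ _ => hκ q S
      · simp at hS ⊢; exact hS.2
      · obtain ⟨hS1, hS2⟩ := Finset.mem_filter.1 hS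
        refine Finset.mem_filter.2 ⟨Finset.mem_univ _, hS2, fun j hj hjx => ?_⟩
        exact (Finset.mem_filter.1 (hsub j hj hjx hS1)).2.2
    linarith
  have hdecay : ∀ c ∈ C, (transition ν ^ i) (fun M' => if p c M' then (1 : ℝ) else 0) M₀ ≤
      Real.exp (-(i * w / 4)) := by
    intro c hc
    have hcN : (N : ℝ) ≤ ∑ q, ((c q : ℕ) : ℝ) := by exact_mod_cast (Finset.mem_filter.1 hc).2.1
    refine (transition_pow_indicator_le hν h1 (p := p c) (θ := w / 4) ?_ ?_ i M₀).trans
      (le_of_eq (by rw [mul_div_assoc]))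
    · rintro M S ⟨h2, h3⟩
      refine ⟨survivors_subset _ _ h2, fun q hq => ?_⟩
      obtain ⟨j, hj, h⟩ := h3 q hq
      exact ⟨j, survivors_subset _ _ hj, h⟩
    · intro M hM
      have hq : ∀ q, η * (c q : ℕ) ≤ ∑ S with ¬ p c (survivors M S), κ q S := by
        intro q
        by_cases hc0 : (c q : ℕ) = 0
        · rw [hc0]; simpa using Finset.sum_nonneg fun S _ => hκ q S
        refine (hkill q _ M (hM.2 q hc0)).trans ?_
        refine Finset.sum_le_sum_of_subset_of_nonneg (fun S hS => ?_) fun S _ _ => hκ q S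
        simp only [Finset.mem_filter, Finset.mem_univ, true_and] at hS ⊢
        rintro ⟨-, h⟩
        obtain ⟨j, hj, hjx⟩ := h q hc0
        have hne : (M \ S).Nonempty := ⟨a, by simp [hM.1, hS.1]⟩
        have hjM := survivors_subset _ _ hj
        exact (notMem_survivors hjM).2 ⟨hS.2 j hjM hjx, hne⟩ hj
      calc w / 4 ≤ η * N := by linarith
        _ ≤ η * ∑ q, ((c q : ℕ) : ℝ) := by gcongr
        _ ≤ ∑ q, ∑ S with ¬ p c (survivors M S), κ q S := by
          rw [Finset.mul_sum]; exact Finset.sum_le_sum fun q _ => hq q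
        _ = _ := by rw [Finset.sum_comm]; exact Finset.sum_congr rfl fun S _ => (hνκ S).symm
  refine hcover.trans ?_
  rw [map_sum, Finset.sum_apply]
  calc _ ≤ ∑ c ∈ C, Real.exp (-(i * w / 4)) := Finset.sum_le_sum hdecay
    _ = C.card * Real.exp (-(i * w / 4)) := by rw [Finset.sum_const, nsmul_eq_mul]
    _ ≤ _ := by gcongr; exact card_net_le

end Tail

/-! ### The trees of the procedure -/

section Tree

variable {d k : ℕ} {μ : Fin k → Fin d → ℝ}

open Classical in
/-- The centers that the cut `c` separates from the point `x`. -/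
noncomputable def cutOff (μ : Fin k → Fin d → ℝ) (x : Fin d → ℝ) (c : Fin d × ℝ) :
    Finset (Fin k) :=
  Finset.univ.filter fun i => ¬ (x c.1 < c.2 ↔ μ i c.1 < c.2)

lemma mem_cutOff {x : Fin d → ℝ} {c : Fin d × ℝ} {i : Fin k} :
    i ∈ cutOff μ x c ↔ ¬ (x c.1 < c.2 ↔ μ i c.1 < c.2) := by simp [cutOff]

namespace ThresholdTree

lemma leafOf_applyCut (x : Fin d → ℝ) (c : Fin d × ℝ) (t : ThresholdTree d k) :
    (t.applyCut μ c).leafOf x = survivors (t.leafOf x) (cutOff μ x c) := by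
  induction t with
  | leaf M =>
    rw [applyCut]
    by_cases hx : x c.1 < c.2
    · have e : M \ cutOff μ x c = M.filter fun i => μ i c.1 < c.2 := by
        ext i; simp [mem_cutOff, hx]
      split_ifs with h
      · have hne : (M.filter fun i => μ i c.1 < c.2).Nonempty := by
          obtain ⟨i, hi, h'⟩ := h.1; exact ⟨i, by simp [hi, h']⟩
        simp [leafOf, hx, survivors, e, hne]
      · simp only [leafOf, survivors, e]
        split_ifs with hne
        · obtain ⟨i, hi⟩ := hne
          rw [Finset.mem_filter] at hi
          have hall : ∀ j ∈ M, μ j c.1 < c.2 := fun j hj =>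
            not_le.1 fun h' => h ⟨⟨i, hi⟩, ⟨j, hj, h'⟩⟩
          exact (Finset.filter_true_of_mem hall).symm
        · rfl
    · have e : M \ cutOff μ x c = M.filter fun i => c.2 ≤ μ i c.1 := by
        ext i; simp [mem_cutOff, hx]
      split_ifs with h
      · have hne : (M.filter fun i => c.2 ≤ μ i c.1).Nonempty := by
          obtain ⟨i, hi, h'⟩ := h.2; exact ⟨i, by simp [hi, h']⟩
        simp [leafOf, hx, survivors, e, hne]
      · simp only [leafOf, survivors, e]
        split_ifs with hne
        · obtain ⟨i, hi⟩ := hne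
          rw [Finset.mem_filter] at hi
          have hall : ∀ j ∈ M, c.2 ≤ μ j c.1 := fun j hj =>
            not_lt.1 fun h' => h ⟨⟨j, hj, h'⟩, ⟨i, hi⟩⟩
          exact (Finset.filter_true_of_mem hall).symm
        · rfl
  | node r z L R hL hR =>
    simp only [applyCut, leafOf]
    split_ifs <;> assumption

lemma leafOf_mem_leaves (x : Fin d → ℝ) (t : ThresholdTree d k) : t.leafOf x ∈ t.leaves := by
  induction t with
  | leaf M => simp [leafOf, leaves]
  | node r z L R hL hR =>
    simp only [leafOf, leaves, List.mem_append]
    split_ifs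
    · exact Or.inl hL
    · exact Or.inr hR

lemma exists_of_mem_leaves_applyCut {c : Fin d × ℝ} {t : ThresholdTree d k} {M' : Finset (Fin k)}
    (h : M' ∈ (t.applyCut μ c).leaves) :
    ∃ M ∈ t.leaves, M' ⊆ M ∧ (M.Nonempty → M'.Nonempty) ∧
      ∀ i ∈ M', ∀ j ∈ M', μ i c.1 < c.2 → μ j c.1 < c.2 := by
  induction t with
  | leaf M =>
    refine ⟨M, by simp [leaves], ?_⟩
    rw [applyCut] at h
    split_ifs at h with hs
    · simp only [leaves, List.cons_append, List.nil_append, List.mem_cons, List.not_mem_nil,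
        or_false] at h
      rcases h with rfl | rfl
      · refine ⟨Finset.filter_subset _ _, fun _ => ?_, ?_⟩
        · obtain ⟨i, hi, h'⟩ := hs.1; exact ⟨i, by simp [hi, h']⟩
        · intro i _ j hj _; exact (Finset.mem_filter.1 hj).2
      · refine ⟨Finset.filter_subset _ _, fun _ => ?_, ?_⟩
        · obtain ⟨i, hi, h'⟩ := hs.2; exact ⟨i, by simp [hi, h']⟩
        · intro i hi j _ h'; exact absurd h' (not_lt.2 (Finset.mem_filter.1 hi).2)
    · simp only [leaves, List.mem_singleton] at h
      subst h
      refine ⟨subset_rfl, id, fun i hi j hj h' => ?_⟩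
      exact not_le.1 fun h2 => hs ⟨⟨i, hi, h'⟩, ⟨j, hj, h2⟩⟩
  | node r z L R hL hR =>
    simp only [applyCut, leaves, List.mem_append] at h ⊢
    rcases h with h | h
    · obtain ⟨M, hM, h'⟩ := hL h; exact ⟨M, Or.inl hM, h'⟩
    · obtain ⟨M, hM, h'⟩ := hR h; exact ⟨M, Or.inr hM, h'⟩

lemma sum_card_leaves_applyCut (c : Fin d × ℝ) (t : ThresholdTree d k) :
    ((t.applyCut μ c).leaves.map Finset.card).sum = (t.leaves.map Finset.card).sum := by
  induction t with
  | leaf M =>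
    rw [applyCut]
    split_ifs with hs
    · have := Finset.card_filter_add_card_filter_not (s := M) (fun i => μ i c.1 < c.2)
      simp only [not_lt] at this
      simpa [leaves] using this
    · rfl
  | node r z L R hL hR => simp [applyCut, leaves, hL, hR]

lemma Separated.applyCut_eq {t : ThresholdTree d k} (h : t.Separated) (c : Fin d × ℝ) :
    t.applyCut μ c = t := by
  induction t with
  | leaf M =>
    have h1 : M.card = 1 := h M (by simp [leaves])
    obtain ⟨s, rfl⟩ := Finset.card_eq_one.1 h1
    rw [applyCut, if_neg]
    simp
  | node r z L R hL hR =>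
    rw [applyCut, hL fun M hM => h M (by simp [leaves, hM]),
      hR fun M hM => h M (by simp [leaves, hM])]

end ThresholdTree

open ThresholdTree

/-- The center set of the leaf that `x` reaches after `n` cuts. -/
noncomputable def leafAfter (μ : Fin k → Fin d → ℝ) (x : Fin d → ℝ) (c : ℕ → Fin d × ℝ) (n : ℕ) :
    Finset (Fin k) :=
  (treeAfter μ c n).leafOf x

lemma leafAfter_zero (x : Fin d → ℝ) (c : ℕ → Fin d × ℝ) :
    leafAfter μ x c 0 = Finset.univ := rfl

lemma leafAfter_succ (x : Fin d → ℝ) (c : ℕ → Fin d × ℝ) (n : ℕ) :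
    leafAfter μ x c (n + 1) = survivors (leafAfter μ x c n) (cutOff μ x (c n)) :=
  leafOf_applyCut x (c n) _

lemma leafAfter_congr (x : Fin d → ℝ) {c c' : ℕ → Fin d × ℝ} {n : ℕ} (h : ∀ i < n, c i = c' i) :
    leafAfter μ x c n = leafAfter μ x c' n := by
  induction n with
  | zero => rfl
  | succ n ih =>
    rw [leafAfter_succ, leafAfter_succ, ih fun i hi => h i (by omega), h n (by omega)]

lemma sum_card_leaves_treeAfter (c : ℕ → Fin d × ℝ) (n : ℕ) :
    ((treeAfter μ c n).leaves.map Finset.card).sum = k := by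
  induction n with
  | zero => simp [treeAfter, leaves]
  | succ n ih => rw [treeAfter, sum_card_leaves_applyCut, ih]

lemma length_leaves_of_separated {c : ℕ → Fin d × ℝ} {n : ℕ} (h : (treeAfter μ c n).Separated) :
    (treeAfter μ c n).leaves.length = k := by
  have := sum_card_leaves_treeAfter (μ := μ) c n
  rw [List.map_congr_left h] at this
  simpa using this

lemma treeAfter_eq_of_separated {c : ℕ → Fin d × ℝ} {m n : ℕ} (h : (treeAfter μ c m).Separated)
    (hmn : m ≤ n) : treeAfter μ c n = treeAfter μ c m := by
  induction n, hmn using Nat.le_induction with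
  | base => rfl
  | succ n _ ih => rw [treeAfter, ih, h.applyCut_eq]

lemma separated_outputTree {c : ℕ → Fin d × ℝ} (h : Terminates μ c) :
    (outputTree μ c).Separated := Nat.sInf_mem h

lemma leaf_treeAfter [NeZero k] {c : ℕ → Fin d × ℝ} {n : ℕ} {M : Finset (Fin k)}
    (hM : M ∈ (treeAfter μ c n).leaves) :
    M.Nonempty ∧ ∀ m < n, ∀ i ∈ M, ∀ j ∈ M, μ i (c m).1 < (c m).2 → μ j (c m).1 < (c m).2 := by
  induction n generalizing M with
  | zero =>
    simp only [treeAfter, leaves, List.mem_singleton] at hM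
    subst hM
    exact ⟨Finset.univ_nonempty, fun m hm => absurd hm (by omega)⟩
  | succ n ih =>
    obtain ⟨M', hM', hsub, hne, hside⟩ := exists_of_mem_leaves_applyCut hM
    obtain ⟨h1, h2⟩ := ih hM'
    refine ⟨hne h1, fun m hm i hi j hj => ?_⟩
    rcases Nat.lt_succ_iff_lt_or_eq.1 hm with hm | rfl
    · exact h2 m hm i (hsub hi) j (hsub hj)
    · exact hside i hi j hj

lemma terminates_of_forall_cut [NeZero k] {c : ℕ → Fin d × ℝ}
    (h : ∀ i j, i ≠ j → ∃ n, i ∈ cutOff μ (μ j) (c n)) : Terminates μ c := by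
  choose! f hf using h
  let N := Finset.univ.sup fun p : Fin k × Fin k => f p.1 p.2
  have hN : ∀ i j, f i j ≤ N := fun i j =>
    Finset.le_sup (f := fun p : Fin k × Fin k => f p.1 p.2) (Finset.mem_univ (i, j))
  refine ⟨N + 1, fun M hM => ?_⟩
  obtain ⟨hne, hside⟩ := leaf_treeAfter hM
  obtain ⟨s, hs⟩ := hne
  refine Finset.card_eq_one.2 ⟨s, Finset.eq_singleton_iff_unique_mem.2 ⟨hs, fun j hj => ?_⟩⟩
  by_contra hne
  have hlt : f j s < N + 1 := Nat.lt_succ_of_le (hN j s)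
  exact mem_cutOff.1 (hf j s hne) ⟨hside _ hlt s hs j hj, hside _ hlt j hj s hs⟩

/-- If the procedure terminates, the leaf of `x` is eventually the single center assigned to `x`. -/
lemma eventually_leafAfter_eq [NeZero k] {c : ℕ → Fin d × ℝ} (h : Terminates μ c)
    (x : Fin d → ℝ) : ∀ᶠ n in Filter.atTop, leafAfter μ x c n = {assigned μ c x} := by
  have hs := separated_outputTree h
  obtain ⟨s, hM⟩ := Finset.card_eq_one.1 (hs _ (leafOf_mem_leaves x _))
  have hass : assigned μ c x = s := by
    have : assigned μ c x ∈ (outputTree μ c).leafOf x :=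
      Classical.epsilon_spec (p := fun i => i ∈ (outputTree μ c).leafOf x) ⟨s, by simp [hM]⟩
    simpa [hM] using this
  filter_upwards [Filter.eventually_ge_atTop (sInf {n | (treeAfter μ c n).Separated})] with n hn
  rw [leafAfter, treeAfter_eq_of_separated hs hn, hass]
  exact hM

end Tree

/-! ### The law of a random cut -/

section CutLaw

variable {d k : ℕ} {μ : Fin k → Fin d → ℝ}

/-- The expectation of a function of a random variable with finitely many values. -/
lemma integral_comp_eq_sum {Ω α : Type*} [MeasurableSpace Ω] {P : Measure Ω} [IsFiniteMeasure P]
    [Fintype α] {Z : Ω → α} (hZ : ∀ a, MeasurableSet (Z ⁻¹' {a})) (f : α → ℝ) :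
    ∫ ω, f (Z ω) ∂P = ∑ a, P.real (Z ⁻¹' {a}) * f a := by
  classical
  have e : (fun ω => f (Z ω)) = fun ω => ∑ a, (Z ⁻¹' {a}).indicator (fun _ => f a) ω := by
    ext ω
    rw [Finset.sum_eq_single (Z ω)]
    · simp
    · intro a _ ha; simp [ha.symm]
    · simp
  rw [e, integral_finsetSum _ fun a _ => (integrable_const (f a)).indicator (hZ a)]
  simp [integral_indicator_const _ (hZ _)]

lemma measurable_comp_of_fibers {Ω α : Type*} [MeasurableSpace Ω] [Finite α] {Z : Ω → α}
    (hZ : ∀ a, MeasurableSet (Z ⁻¹' {a})) (f : α → ℝ) : Measurable fun ω => f (Z ω) := by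
  let : MeasurableSpace α := ⊤
  have hZ' : Measurable Z := measurable_to_countable' hZ
  exact measurable_from_top.comp hZ'

lemma measurableSet_lt_cut (x : Fin d → ℝ) :
    MeasurableSet {c : Fin d × ℝ | x c.1 < c.2} :=
  measurableSet_lt ((Measurable.of_discrete (f := x)).comp measurable_fst) measurable_snd

lemma measurableSet_mem_cutOff (μ : Fin k → Fin d → ℝ) (x : Fin d → ℝ) (i : Fin k) :
    MeasurableSet {c | i ∈ cutOff μ x c} := by
  simp only [mem_cutOff]
  exact ((measurableSet_lt_cut x).iff (measurableSet_lt_cut (μ i))).compl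

lemma measurableSet_cutOff_eq (μ : Fin k → Fin d → ℝ) (x : Fin d → ℝ) (S : Finset (Fin k)) :
    MeasurableSet (cutOff μ x ⁻¹' {S}) := by
  have : cutOff μ x ⁻¹' {S} = ⋂ i, {c | i ∈ cutOff μ x c ↔ i ∈ S} := by
    ext c; simp [Finset.ext_iff]
  rw [this]
  exact MeasurableSet.iInter fun i => (measurableSet_mem_cutOff μ x i).iff (MeasurableSet.const _)

lemma measurableSet_leafAfter_eq {Ω : Type*} [MeasurableSpace Ω] {c : ℕ → Ω → Fin d × ℝ}
    (hc : ∀ n, Measurable (c n)) (μ : Fin k → Fin d → ℝ) (x : Fin d → ℝ) (n : ℕ)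
    (M : Finset (Fin k)) : MeasurableSet ((fun ω => leafAfter μ x (fun i => c i ω) n) ⁻¹' {M}) := by
  induction n generalizing M with
  | zero => simp only [leafAfter_zero]; exact MeasurableSet.const _
  | succ n ih =>
    have : (fun ω => leafAfter μ x (fun i => c i ω) (n + 1)) ⁻¹' {M} =
        ⋃ p : {p : Finset (Fin k) × Finset (Fin k) // survivors p.1 p.2 = M},
          ((fun ω => leafAfter μ x (fun i => c i ω) n) ⁻¹' {p.1.1}) ∩
            (c n ⁻¹' (cutOff μ x ⁻¹' {p.1.2})) := by
      ext ω
      simp [leafAfter_succ]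
    rw [this]
    exact MeasurableSet.iUnion fun p => (ih _).inter (hc n (measurableSet_cutOff_eq μ x _))

instance isProbabilityMeasure_cutLaw [NeZero d] {B : ℝ} [Fact (0 < B)] :
    IsProbabilityMeasure (cutLaw d B) := by
  have hB : 0 < B := Fact.out
  have h1 : IsProbabilityMeasure (uniformOn (Set.univ : Set (Fin d))) :=
    isProbabilityMeasure_uniformOn Set.finite_univ Set.univ_nonempty
  have h2 : IsProbabilityMeasure (cond volume (Set.Icc (-B) B)) :=
    cond_isProbabilityMeasure_of_finite (by simp [hB]) (by simp)
  unfold cutLaw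
  infer_instance

/-- The distribution of the set of centers that a random cut separates from `x`. -/
noncomputable def cutOffLaw (μ : Fin k → Fin d → ℝ) (B : ℝ) (x : Fin d → ℝ) (S : Finset (Fin k)) :
    ℝ :=
  (cutLaw d B).real (cutOff μ x ⁻¹' {S})

lemma cutOffLaw_nonneg (B : ℝ) (x : Fin d → ℝ) (S : Finset (Fin k)) : 0 ≤ cutOffLaw μ B x S :=
  measureReal_nonneg

lemma sum_cutOffLaw [NeZero d] {B : ℝ} [Fact (0 < B)] (x : Fin d → ℝ) :
    ∑ S, cutOffLaw μ B x S = 1 := by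
  have := integral_comp_eq_sum (P := cutLaw d B) (measurableSet_cutOff_eq μ x) (fun _ => 1)
  simpa [cutOffLaw] using this.symm

lemma rate_cutOffLaw [NeZero d] {B : ℝ} [Fact (0 < B)] (x : Fin d → ℝ) (i : Fin k) :
    rate (cutOffLaw μ B x) i = (cutLaw d B).real {c | i ∈ cutOff μ x c} := by
  have := integral_comp_eq_sum (P := cutLaw d B) (measurableSet_cutOff_eq μ x)
    (fun S => if i ∈ S then 1 else 0)
  simp only [mul_ite, mul_one, mul_zero, ← Finset.sum_filter] at this
  rw [rate]
  refine this.symm.trans ?_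
  rw [← integral_indicator_one (measurableSet_mem_cutOff μ x i)]
  congr 1 with c
  simp [Set.indicator]

lemma cutLaw_apply (B : ℝ) {s : Set (Fin d × ℝ)} (hs : MeasurableSet s) :
    cutLaw d B s = (d : ENNReal)⁻¹ * ∑ r, cond volume (Set.Icc (-B) B) (Prod.mk r ⁻¹' s) := by
  rw [cutLaw, Measure.prod_apply hs, uniformOn, ProbabilityTheory.cond, lintegral_smul_measure,
    Measure.restrict_univ, lintegral_count, tsum_fintype]
  simp

/-- A uniform threshold in `[-B, B]` separates `y ∈ [-B, B]` from a number `x` with probability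
proportional to the distance from `y` to the projection of `x` to `[-B, B]`. -/
lemma cond_volume_separating {B : ℝ} (hB : 0 < B) (x : ℝ) {y : ℝ} (hy : y ∈ Set.Icc (-B) B) :
    cond volume (Set.Icc (-B) B) {z | ¬ (x < z ↔ y < z)} =
      ENNReal.ofReal (|max (-B) (min x B) - y| / (2 * B)) := by
  have hvol : volume (Set.Icc (-B) B ∩ {z | ¬ (x < z ↔ y < z)}) =
      ENNReal.ofReal |max (-B) (min x B) - y| := by
    rcases le_total x y with h | h
    · have e : Set.Icc (-B) B ∩ {z | ¬ (x < z ↔ y < z)} = Set.Icc (-B) B ∩ Set.Ioc x y := by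
        ext z
        simp only [Set.mem_inter_iff, Set.mem_ofPred_eq, Set.mem_Ioc]
        grind
      have e2 : (Set.Icc (-B) B ∩ Set.Ioc x y : Set ℝ) =ᵐ[volume] Set.Ioc (max (-B) x) y := by
        have : (Set.Icc (-B) B ∩ Set.Ioc x y : Set ℝ) =ᵐ[volume]
            (Set.Ioc (-B) B ∩ Set.Ioc x y : Set ℝ) :=
          ae_eq_set_inter Ioc_ae_eq_Icc.symm Filter.EventuallyEq.rfl
        rw [Set.Ioc_inter_Ioc, inf_eq_right.2 hy.2] at this
        exact this
      rw [e, measure_congr e2, Real.volume_Ioc, min_eq_left (h.trans hy.2), abs_sub_comm,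
        abs_of_nonneg (sub_nonneg.2 (max_le hy.1 h))]
    · have e : Set.Icc (-B) B ∩ {z | ¬ (x < z ↔ y < z)} = Set.Icc (-B) B ∩ Set.Ioc y x := by
        ext z
        simp only [Set.mem_inter_iff, Set.mem_ofPred_eq, Set.mem_Ioc]
        grind
      have e2 : (Set.Icc (-B) B ∩ Set.Ioc y x : Set ℝ) =ᵐ[volume] Set.Ioc y (min x B) := by
        have : (Set.Icc (-B) B ∩ Set.Ioc y x : Set ℝ) =ᵐ[volume]
            (Set.Ioc (-B) B ∩ Set.Ioc y x : Set ℝ) :=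
          ae_eq_set_inter Ioc_ae_eq_Icc.symm Filter.EventuallyEq.rfl
        rw [Set.Ioc_inter_Ioc, sup_eq_right.2 hy.1, inf_comm] at this
        exact this
      have h2 : y ≤ min x B := le_min h hy.2
      rw [e, measure_congr e2, Real.volume_Ioc, max_eq_right (hy.1.trans h2),
        abs_of_nonneg (sub_nonneg.2 h2)]
  rw [cond_apply measurableSet_Icc, hvol, Real.volume_Icc,
    ← ENNReal.ofReal_inv_of_pos (by linarith), ← ENNReal.ofReal_mul (by simp [hB.le])]
  congr 1
  rw [sub_neg_eq_add, ← two_mul, div_eq_mul_inv, mul_comm]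

/-- The `ℓ₁` distances to the centers are an affine function of the rates; the constant term is the
distance from `x` to the box. -/
lemma exists_l1dist_eq [NeZero d] {B : ℝ} [Fact (0 < B)] (hμ : ∀ i r, μ i r ∈ Set.Icc (-B) B)
    (x : Fin d → ℝ) :
    ∃ b, 0 ≤ b ∧ ∀ i, l1dist x (μ i) = b + 2 * B * d * rate (cutOffLaw μ B x) i := by
  have hB : 0 < B := Fact.out
  have hd : (0 : ℝ) < d := by exact_mod_cast NeZero.pos d
  refine ⟨∑ r, |x r - max (-B) (min (x r) B)|, Finset.sum_nonneg fun r _ => abs_nonneg _,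
    fun i => ?_⟩
  have hr : rate (cutOffLaw μ B x) i =
      (d : ℝ)⁻¹ * ∑ r, |max (-B) (min (x r) B) - μ i r| / (2 * B) := by
    rw [rate_cutOffLaw, measureReal_def, cutLaw_apply B (measurableSet_mem_cutOff μ x i)]
    have : ∀ r, cond volume (Set.Icc (-B) B) (Prod.mk r ⁻¹' {c | i ∈ cutOff μ x c}) =
        ENNReal.ofReal (|max (-B) (min (x r) B) - μ i r| / (2 * B)) := by
      intro r
      rw [← cond_volume_separating hB (x r) (hμ i r)]
      congr 1
      ext z
      simp only [Set.mem_preimage, Set.mem_ofPred_eq, mem_cutOff]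
    simp only [this]
    rw [← ENNReal.ofReal_sum_of_nonneg fun r _ => by positivity, ENNReal.toReal_mul,
      ENNReal.toReal_ofReal (Finset.sum_nonneg fun r _ => by positivity)]
    simp
  rw [hr, ← Finset.sum_div, l1dist]
  have e : 2 * B * d * ((d : ℝ)⁻¹ * ((∑ r, |max (-B) (min (x r) B) - μ i r|) / (2 * B))) =
      ∑ r, |max (-B) (min (x r) B) - μ i r| := by field_simp
  rw [e, ← Finset.sum_add_distrib]
  refine Finset.sum_congr rfl fun r _ => ?_
  obtain ⟨h1, h2⟩ := hμ i r
  rcases le_total (x r) B with h3 | h3 <;> rcases le_total (-B) (x r) with h4 | h4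
  · rw [min_eq_left h3, max_eq_right h4]; simp
  · rw [min_eq_left h3, max_eq_left h4, abs_of_nonpos (by linarith), abs_of_nonpos (by linarith),
      abs_of_nonpos (by linarith)]
    ring
  · rw [min_eq_right h3, max_eq_right (by linarith), abs_of_nonneg (by linarith),
      abs_of_nonneg (by linarith), abs_of_nonneg (by linarith)]
    ring
  · linarith

/-- The cuts in one direction and on one side of `x` are nested, so the tail bound by the number of
directions applies. -/
lemma hasTail_cutOffLaw [NeZero d] {B : ℝ} [Fact (0 < B)] (x : Fin d → ℝ) :
    HasTail (cutOffLaw μ B x) (8 ^ (2 * d)) := by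
  classical
  let Z : Fin d × ℝ → Finset (Fin k) × (Fin d × Bool) :=
    fun c => (cutOff μ x c, (c.1, decide (x c.1 < c.2)))
  have hZ : ∀ p, MeasurableSet (Z ⁻¹' {p}) := by
    rintro ⟨S, r, b⟩
    have : Z ⁻¹' {(S, r, b)} = cutOff μ x ⁻¹' {S} ∩
        ((fun c => c.1) ⁻¹' {r} ∩ {c | x c.1 < c.2 ↔ b = true}) := by
      ext c
      cases b <;> simp [Z]
    rw [this]
    exact (measurableSet_cutOff_eq μ x S).inter ((measurable_fst (measurableSet_singleton r)).inter
      ((measurableSet_lt_cut x).iff (MeasurableSet.const _)))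
  have hcard : 8 ^ (2 * d) = (8 : ℝ) ^ Fintype.card (Fin d × Bool) := by
    simp [Fintype.card_prod, mul_comm]
  rw [hcard]
  refine hasTail_of_chains (κ := fun q S => (cutLaw d B).real (Z ⁻¹' {(S, q)}))
    (fun q S => measureReal_nonneg) (fun S => ?_) (sum_cutOffLaw x) ?_
  · have h1 := integral_comp_eq_sum (P := cutLaw d B) hZ (fun p => if p.1 = S then 1 else 0)
    have h2 := integral_comp_eq_sum (P := cutLaw d B) (measurableSet_cutOff_eq μ x)
      (fun S' => if S' = S then 1 else 0)
    have h3 : cutOffLaw μ B x S =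
        ∑ p, (cutLaw d B).real (Z ⁻¹' {p}) * if p.1 = S then 1 else 0 := by
      rw [← h1]
      simpa [cutOffLaw] using h2.symm
    rw [h3, Fintype.sum_prod_type]
    simp
  · rintro ⟨r, b⟩ S S' hS hS'
    have hex : ∀ S, (cutLaw d B).real (Z ⁻¹' {(S, (r, b))}) ≠ 0 → ∃ z, cutOff μ x (r, z) = S ∧
        (x r < z ↔ b = true) := by
      intro S hS
      have hne : (Z ⁻¹' {(S, (r, b))}).Nonempty := by
        by_contra h
        rw [Set.not_nonempty_iff_eq_empty.1 h] at hS
        simp at hS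
      obtain ⟨⟨r', z⟩, h⟩ := hne
      simp only [Z, Set.mem_preimage, Set.mem_singleton_iff, Prod.mk.injEq] at h
      obtain ⟨h1, rfl, rfl⟩ := h
      exact ⟨z, h1, by simp⟩
    obtain ⟨z, rfl, hz⟩ := hex S hS
    obtain ⟨z', rfl, hz'⟩ := hex S' hS'
    cases b
    · simp only [Bool.false_eq_true, iff_false] at hz hz'
      rcases le_total z z' with h | h
      · left; intro i hi
        simp only [mem_cutOff, hz, hz', false_iff, not_not] at hi ⊢
        linarith
      · right; intro i hi
        simp only [mem_cutOff, hz, hz', false_iff, not_not] at hi ⊢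
        linarith
    · simp only [iff_true] at hz hz'
      rcases le_total z z' with h | h
      · right; intro i hi
        simp only [mem_cutOff, hz, hz', true_iff, not_lt] at hi ⊢
        linarith
      · left; intro i hi
        simp only [mem_cutOff, hz, hz', true_iff, not_lt] at hi ⊢
        linarith

end CutLaw

/-! ### The expected distance to the assigned center -/

section CutSequence

variable {d k : ℕ} {μ : Fin k → Fin d → ℝ} {Ω : Type*} [MeasurableSpace Ω] {P : Measure Ω}
  {B : ℝ} {cut : ℕ → Ω → Fin d × ℝ}

/-- The `n`-th cut is independent of the leaf that `x` has reached before. -/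
lemma measureReal_leafAfter_inter_cut [NeZero d] (h : IsUniformCuts B P cut) (x : Fin d → ℝ)
    (n : ℕ) (M S : Finset (Fin k)) :
    P.real ((fun ω => leafAfter μ x (fun i => cut i ω) n) ⁻¹' {M} ∩
        cut n ⁻¹' (cutOff μ x ⁻¹' {S})) =
      P.real ((fun ω => leafAfter μ x (fun i => cut i ω) n) ⁻¹' {M}) * cutOffLaw μ B x S := by
  have hind := h.indep.indepFun_finset (Finset.range n) {n} (by simp) h.measurable
  let c : ℕ → (Finset.range n → Fin d × ℝ) → Fin d × ℝ :=
    fun i v => if hi : i ∈ Finset.range n then v ⟨i, hi⟩ else (0, 0)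
  have hc : ∀ i, Measurable (c i) := by
    intro i
    by_cases hi : i ∈ Finset.range n
    · simp only [c, hi, dif_pos]; exact measurable_pi_apply _
    · simp only [c, hi, dif_neg, not_false_eq_true]; exact measurable_const
  have e1 : (fun ω => leafAfter μ x (fun i => cut i ω) n) ⁻¹' {M} =
      (fun ω (i : Finset.range n) => cut i ω) ⁻¹'
        ((fun v => leafAfter μ x (fun i => c i v) n) ⁻¹' {M}) := by
    ext ω
    simp only [Set.mem_preimage]
    rw [leafAfter_congr x (c' := fun i => c i fun j : Finset.range n => cut j ω)]
    intro i hi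
    simp [c, hi]
  have e2 : cut n ⁻¹' (cutOff μ x ⁻¹' {S}) =
      (fun ω (i : ({n} : Finset ℕ)) => cut i ω) ⁻¹'
        ((fun v => v ⟨n, by simp⟩) ⁻¹' (cutOff μ x ⁻¹' {S})) := rfl
  have e3 : P.real (cut n ⁻¹' (cutOff μ x ⁻¹' {S})) = cutOffLaw μ B x S := by
    rw [cutOffLaw, ← h.law n,
      map_measureReal_apply (h.measurable n) (measurableSet_cutOff_eq μ x S)]
  rw [← e3, measureReal_def, measureReal_def, measureReal_def, ← ENNReal.toReal_mul, e1, e2,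
    hind.measure_inter_preimage_eq_mul _ _ (measurableSet_leafAfter_eq hc μ x n M)
      (measurable_pi_apply _ (measurableSet_cutOff_eq μ x S))]

/-- The leaf of `x` is a Markov chain with the transition operator of `cutOffLaw`. -/
lemma integral_leafAfter [NeZero d] [IsProbabilityMeasure P] (h : IsUniformCuts B P cut)
    (x : Fin d → ℝ) (n : ℕ) (f : Finset (Fin k) → ℝ) :
    ∫ ω, f (leafAfter μ x (fun i => cut i ω) n) ∂P =
      (transition (cutOffLaw μ B x) ^ n) f Finset.univ := by
  induction n generalizing f with
  | zero => simp [leafAfter_zero]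
  | succ n ih =>
    rw [pow_succ, Module.End.mul_apply, ← ih]
    have hm := measurableSet_leafAfter_eq h.measurable μ x n
    have e : ∀ M S : Finset (Fin k),
        (fun ω => (leafAfter μ x (fun i => cut i ω) n, cutOff μ x (cut n ω))) ⁻¹' {(M, S)} =
        (fun ω => leafAfter μ x (fun i => cut i ω) n) ⁻¹' {M} ∩
          cut n ⁻¹' (cutOff μ x ⁻¹' {S}) := by
      intro M S; ext ω; simp
    have h1 := integral_comp_eq_sum (P := P)
      (Z := fun ω => (leafAfter μ x (fun i => cut i ω) n, cutOff μ x (cut n ω)))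
      (fun p => by
        rw [e p.1 p.2]
        exact (hm _).inter (h.measurable n (measurableSet_cutOff_eq μ x _)))
      (fun p => f (survivors p.1 p.2))
    simp only [leafAfter_succ]
    rw [h1, integral_comp_eq_sum hm, Fintype.sum_prod_type]
    refine Finset.sum_congr rfl fun M _ => ?_
    rw [transition_apply, Finset.mul_sum]
    refine Finset.sum_congr rfl fun S _ => ?_
    rw [e, measureReal_leafAfter_inter_cut h, mul_assoc]

/-- A set of cuts of positive probability is almost surely hit. -/
lemma ae_exists_cut_mem [NeZero d] [Fact (0 < B)] (h : IsUniformCuts B P cut)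
    {A : Set (Fin d × ℝ)} (hA : MeasurableSet A) (hpos : 0 < cutLaw d B A) :
    ∀ᵐ ω ∂P, ∃ n, cut n ω ∈ A := by
  have hle : ∀ n : ℕ, P {ω | ¬ ∃ n, cut n ω ∈ A} ≤ (cutLaw d B Aᶜ) ^ n := by
    intro n
    calc P {ω | ¬ ∃ n, cut n ω ∈ A} ≤ P (⋂ i ∈ Finset.range n, cut i ⁻¹' Aᶜ) := by
          refine measure_mono fun ω hω => ?_
          simp only [Set.mem_iInter]
          exact fun i _ hi => hω ⟨i, hi⟩
      _ = ∏ i ∈ Finset.range n, P (cut i ⁻¹' Aᶜ) :=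
          h.indep.measure_inter_preimage_eq_mul _ fun i _ => hA.compl
      _ = _ := by
          rw [Finset.prod_congr rfl fun i _ => by
            rw [← Measure.map_apply (h.measurable i) hA.compl, h.law i]]
          simp
  have hlt : cutLaw d B Aᶜ < 1 := by
    rw [prob_compl_eq_one_sub hA]
    exact ENNReal.sub_lt_self ENNReal.one_ne_top one_ne_zero hpos.ne'
  exact le_antisymm (ge_of_tendsto' (ENNReal.tendsto_pow_atTop_nhds_zero_of_lt_one hlt) hle)
    zero_le

lemma ae_terminates [NeZero d] [NeZero k] [Fact (0 < B)] (h : IsUniformCuts B P cut)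
    (hinj : Function.Injective μ) (hμ : ∀ i r, μ i r ∈ Set.Icc (-B) B) :
    ∀ᵐ ω ∂P, Terminates μ (fun n => cut n ω) := by
  have hB : 0 < B := Fact.out
  have hd : (0 : ℝ) < d := by exact_mod_cast NeZero.pos d
  have hpair : ∀ i j, ∀ᵐ ω ∂P, i ≠ j → ∃ n, cut n ω ∈ {c | i ∈ cutOff μ (μ j) c} := by
    intro i j
    by_cases hij : i = j
    · simp [hij]
    have hpos : 0 < cutLaw d B {c | i ∈ cutOff μ (μ j) c} := by
      obtain ⟨b, hb, hdist⟩ := exists_l1dist_eq (B := B) hμ (μ j)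
      have hself : l1dist (μ j) (μ j) = 0 := by simp [l1dist]
      have hne : 0 < l1dist (μ j) (μ i) := by
        obtain ⟨r, hr⟩ := Function.ne_iff.1 fun h => hij (hinj h).symm
        exact Finset.sum_pos' (fun r _ => abs_nonneg _)
          ⟨r, Finset.mem_univ r, abs_pos.2 (sub_ne_zero.2 hr)⟩
      have hr0 := rate_nonneg (cutOffLaw_nonneg (μ := μ) B (μ j)) j
      have hj := hdist j
      have hi := hdist i
      have hBd : 0 < 2 * B * d := by positivity
      have hb0 : b ≤ 0 := by nlinarith
      have hrate : 0 < rate (cutOffLaw μ B (μ j)) i := by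
        by_contra hneg
        nlinarith
      rw [rate_cutOffLaw, measureReal_def] at hrate
      exact (ENNReal.toReal_pos_iff.1 hrate).1
    filter_upwards [ae_exists_cut_mem h (measurableSet_mem_cutOff μ (μ j) i) hpos] with ω hω _
    exact hω
  have hall := ae_all_iff.2 fun i => ae_all_iff.2 (hpair i)
  filter_upwards [hall] with ω hω
  exact terminates_of_forall_cut hω

/-- The bound for a point, for any factor `α` that solves the recursive inequality. -/
lemma integral_l1dist_assigned_le [NeZero d] [NeZero k] [Fact (0 < B)] [IsProbabilityMeasure P]
    (h : IsUniformCuts B P cut) (hinj : Function.Injective μ)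
    (hμ : ∀ i r, μ i r ∈ Set.Icc (-B) B) (x : Fin d → ℝ) :
    Integrable (fun ω => l1dist x (μ (assigned μ (fun n => cut n ω) x))) P ∧
    ∀ K L α : ℝ, HasTail (cutOffLaw μ B x) K → 1 ≤ L → K ≤ Real.exp L →
      38 + 80 * L * Real.log (1 + α) ≤ α → 0 < α →
      ∫ ω, l1dist x (μ (assigned μ (fun n => cut n ω) x)) ∂P ≤ α * distToCenters μ x := by
  have hB : 0 < B := Fact.out
  set ν := cutOffLaw μ B x with hν
  have hν0 : ∀ S, 0 ≤ ν S := cutOffLaw_nonneg B x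
  have hν1 : ∑ S, ν S = 1 := sum_cutOffLaw x
  obtain ⟨b, hb, hdist⟩ := exists_l1dist_eq hμ x
  set X : Ω → ℝ := fun ω => rate ν (assigned μ (fun n => cut n ω) x) with hX
  set F : ℕ → Ω → ℝ := fun n ω => minRate ν (leafAfter μ x (fun i => cut i ω) n) with hF
  have hFm : ∀ n, AEStronglyMeasurable (F n) P := fun n =>
    (measurable_comp_of_fibers (measurableSet_leafAfter_eq h.measurable μ x n)
      _).aestronglyMeasurable
  have hlim : ∀ᵐ ω ∂P, Filter.Tendsto (fun n => F n ω) Filter.atTop (nhds (X ω)) := by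
    filter_upwards [ae_terminates h hinj hμ] with ω hω
    refine tendsto_nhds_of_eventually_eq ?_
    filter_upwards [eventually_leafAfter_eq hω x] with n hn
    simp [hF, hX, hn, minRate]
  have hFb : ∀ n, ∀ᵐ ω ∂P, ‖F n ω‖ ≤ 1 := fun n => Filter.Eventually.of_forall fun ω => by
    rw [Real.norm_of_nonneg (minRate_nonneg hν0 _)]
    exact (minRate_le_maxRate _).trans (maxRate_le_one hν0 hν1 _)
  have hXm : AEStronglyMeasurable X P := aestronglyMeasurable_of_tendsto_ae _ hFm hlim
  have hXi : Integrable X P := Integrable.of_bound hXm 1 (Filter.Eventually.of_forall fun ω => by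
    rw [Real.norm_of_nonneg (rate_nonneg hν0 _)]
    exact rate_le_one hν0 hν1 _)
  have hconv : Filter.Tendsto (fun n => ∫ ω, F n ω ∂P) Filter.atTop (nhds (∫ ω, X ω ∂P)) :=
    tendsto_integral_of_dominated_convergence (fun _ => 1) hFm (integrable_const 1) hFb hlim
  have hfun : (fun ω => l1dist x (μ (assigned μ (fun n => cut n ω) x))) =
      fun ω => b + 2 * B * d * X ω := funext fun ω => hdist _
  rw [hfun]
  refine ⟨(integrable_const b).add (hXi.const_mul _), fun K L α ht hL hK hα hα0 => ?_⟩
  have hα1 : 1 ≤ α := by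
    have : 0 ≤ 80 * L * Real.log (1 + α) :=
      mul_nonneg (by linarith) (Real.log_nonneg (by linarith))
    linarith
  have hXle : ∫ ω, X ω ∂P ≤ α * minRate ν Finset.univ := by
    refine le_of_tendsto' hconv fun n => ?_
    rw [hF, integral_leafAfter h x n (minRate ν)]
    exact transition_pow_minRate_le hν0 hν1 hL hK ht hα hα0 n _ Finset.univ_nonempty
  have hmin : b + 2 * B * d * minRate ν Finset.univ ≤ distToCenters μ x := by
    refine le_ciInf fun i => ?_
    rw [hdist i]
    gcongr
    exact minRate_le (Finset.mem_univ i)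
  rw [integral_add (integrable_const b) (hXi.const_mul _), integral_const_mul]
  simp only [integral_const, probReal_univ, one_smul]
  calc b + 2 * B * d * ∫ ω, X ω ∂P ≤ b + 2 * B * d * (α * minRate ν Finset.univ) := by gcongr
    _ ≤ α * (b + 2 * B * d * minRate ν Finset.univ) := by nlinarith
    _ ≤ α * distToCenters μ x := by gcongr

end CutSequence

section Factors

lemma mul_log_le_kFactor (k : ℕ) :
    (1 + Real.log k) * (1 + Real.log (1 + Real.log k)) ≤ 100 * kFactor k := by
  set l := Real.log k with hl
  have hl0 : 0 ≤ l := Real.log_natCast_nonneg k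
  have hlog : Real.log (1 + l) ≤ l := by
    have := Real.log_le_sub_one_of_pos (by linarith : 0 < 1 + l); linarith
  have hlog0 : 0 ≤ Real.log (1 + l) := Real.log_nonneg (by linarith)
  rcases le_total l 3 with h | h
  · have : 1 ≤ kFactor k := le_max_left _ _
    nlinarith
  · have h1 : l * Real.log l ≤ kFactor k := le_max_right _ _
    have h2 : 1 ≤ Real.log l := by
      rw [Real.le_log_iff_exp_le (by linarith)]
      have := Real.exp_one_lt_d9
      linarith
    have h3 : Real.log (1 + l) ≤ 1 + Real.log l := by
      have h4 : Real.log (1 + l) ≤ Real.log (2 * l) := Real.log_le_log (by linarith) (by linarith)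
      rw [Real.log_mul (by norm_num) (by linarith)] at h4
      have := Real.log_two_lt_d9
      linarith
    calc (1 + l) * (1 + Real.log (1 + l)) ≤ (2 * l) * (3 * Real.log l) := by
          gcongr <;> linarith
      _ ≤ 100 * kFactor k := by nlinarith

lemma mul_log_le_dFactor (d : ℕ) [NeZero d] :
    (5 * d) * (1 + Real.log (5 * d)) ≤ 100 * dFactor d := by
  have hd : 1 ≤ d := NeZero.one_le
  have hd0 : (0 : ℝ) < d := by exact_mod_cast hd
  have h2 := Real.log_two_gt_d9
  have h5 : Real.log 5 ≤ 3 := by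
    have h := Real.log_le_log (by norm_num) (by norm_num : (5 : ℝ) ≤ 2 ^ 3)
    rw [Real.log_pow] at h
    have := Real.log_two_lt_d9
    push_cast at h
    linarith
  rw [Real.log_mul (by norm_num) hd0.ne']
  rcases hd.eq_or_lt with rfl | hd2
  · have : 1 ≤ dFactor 1 := le_max_left _ _
    simp only [Nat.cast_one, Real.log_one]
    linarith
  · have h1 : d * Real.log d ^ 2 ≤ dFactor d := le_max_right _ _
    have h3 : Real.log 2 ≤ Real.log d := Real.log_le_log (by norm_num) (by exact_mod_cast hd2)
    set t := Real.log d
    have h4 : 5 * (4 + t) ≤ 100 * t ^ 2 := by nlinarith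
    calc 5 * d * (1 + (Real.log 5 + t)) ≤ d * (5 * (4 + t)) := by nlinarith
      _ ≤ d * (100 * t ^ 2) := by gcongr
      _ ≤ 100 * dFactor d := by linarith

end Factors

theorem theorem1 :
    ∃ C : ℝ, 0 < C ∧
      ∀ (d k : ℕ) [NeZero d] [NeZero k] (B : ℝ), 0 < B →
      ∀ μ : Fin k → Fin d → ℝ, Function.Injective μ →
        (∀ i r, μ i r ∈ Set.Icc (-B) B) →
      ∀ (Ω : Type*) [MeasurableSpace Ω] (P : Measure Ω) [IsProbabilityMeasure P]
        (cut : ℕ → Ω → Fin d × ℝ), IsUniformCuts B P cut →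
        -- almost surely the procedure stops, with a tree with `k` leaves, one for each center
        (∀ᵐ ω ∂P, Terminates μ (fun n => cut n ω) ∧
          (outputTree μ (fun n => cut n ω)).Separated ∧
          (outputTree μ (fun n => cut n ω)).leaves.length = k) ∧
        -- the two bounds for a point
        (∀ x : Fin d → ℝ,
          Integrable (fun ω => l1dist x (μ (assigned μ (fun n => cut n ω) x))) P ∧
          ∫ ω, l1dist x (μ (assigned μ (fun n => cut n ω) x)) ∂P
            ≤ C * kFactor k * distToCenters μ x ∧
          ∫ ω, l1dist x (μ (assigned μ (fun n => cut n ω) x)) ∂P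
            ≤ C * dFactor d * distToCenters μ x) ∧
        -- the approximation guarantee for a dataset, from `A`-approximate centers
        (∀ (n : ℕ) (X : Fin n → Fin d → ℝ) (A : ℝ),
          mediansCost μ X ≤ A * mediansOPT k X →
          Integrable (fun ω => treeCost μ (fun n => cut n ω) X) P ∧
          ∫ ω, treeCost μ (fun n => cut n ω) X ∂P
            ≤ C * A * min (kFactor k) (dFactor d) * mediansOPT k X) := by

  refine ⟨100000, by norm_num, ?_⟩
  intro d k _ _ B hB μ hinj hμ Ω _ P _ cut h
  have : Fact (0 < B) := ⟨hB⟩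
  have hd1 : (1 : ℝ) ≤ d := by exact_mod_cast NeZero.one_le (n := d)
  have hdist0 : ∀ x, 0 ≤ distToCenters μ x := fun x =>
    Real.iInf_nonneg fun i => Finset.sum_nonneg fun r _ => abs_nonneg _
  have hfactor : ∀ {L D : ℝ}, L * (1 + Real.log L) ≤ 100 * D →
      ∀ x, 1000 * (L * (1 + Real.log L)) * distToCenters μ x ≤ 100000 * D * distToCenters μ x :=
    fun hD x => mul_le_mul_of_nonneg_right (by linarith) (hdist0 x)
  have hα0 : ∀ {L : ℝ}, 1 ≤ L → 0 < 1000 * (L * (1 + Real.log L)) := fun hL => by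
    have := Real.log_nonneg hL
    positivity
  have point : ∀ x : Fin d → ℝ,
      Integrable (fun ω => l1dist x (μ (assigned μ (fun n => cut n ω) x))) P ∧
      ∫ ω, l1dist x (μ (assigned μ (fun n => cut n ω) x)) ∂P
        ≤ 100000 * kFactor k * distToCenters μ x ∧
      ∫ ω, l1dist x (μ (assigned μ (fun n => cut n ω) x)) ∂P
        ≤ 100000 * dFactor d * distToCenters μ x := by
    intro x
    obtain ⟨hint, hle⟩ := integral_l1dist_assigned_le h hinj hμ x
    refine ⟨hint, ?_, ?_⟩
    · have hL : 1 ≤ 1 + Real.log k := by linarith [Real.log_natCast_nonneg k]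
      have ht := hasTail_card (cutOffLaw_nonneg B x) (sum_cutOffLaw (μ := μ) (B := B) x)
      rw [Fintype.card_fin] at ht
      have hk : (k : ℝ) ≤ Real.exp (1 + Real.log k) := by
        rw [Real.exp_add, Real.exp_log (by exact_mod_cast NeZero.pos k)]
        nlinarith [Real.add_one_le_exp (1 : ℝ), k.cast_nonneg (α := ℝ)]
      exact (hle k _ _ ht hL hk (recursive_inequality hL) (hα0 hL)).trans
        (hfactor (mul_log_le_kFactor k) x)
    · have hL : 1 ≤ 5 * (d : ℝ) := by linarith
      have h8 : (8 : ℝ) ^ (2 * d) ≤ Real.exp (5 * d) := by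
        rw [mul_comm 5 (d : ℝ), Real.exp_nat_mul, pow_mul]
        refine pow_le_pow_left₀ (by norm_num) ?_ d
        calc (8 : ℝ) ^ 2 ≤ 2.7 ^ 5 := by norm_num
          _ ≤ Real.exp 1 ^ 5 := by gcongr; linarith [Real.exp_one_gt_d9]
          _ = Real.exp 5 := by rw [← Real.exp_nat_mul]; norm_num
      exact (hle _ _ _ (hasTail_cutOffLaw x) hL h8 (recursive_inequality hL) (hα0 hL)).trans
        (hfactor (mul_log_le_dFactor d) x)
  refine ⟨?_, point, ?_⟩
  · filter_upwards [ae_terminates h hinj hμ] with ω hω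
    exact ⟨hω, separated_outputTree hω, length_leaves_of_separated (separated_outputTree hω)⟩
  · intro n X A hA
    have hmin0 : 0 ≤ min (kFactor k) (dFactor d) :=
      le_min (zero_le_one.trans (le_max_left _ _)) (zero_le_one.trans (le_max_left _ _))
    refine ⟨integrable_finsetSum _ fun a _ => (point (X a)).1, ?_⟩
    simp only [treeCost]
    rw [integral_finsetSum _ fun a _ => (point (X a)).1]
    calc ∑ a, ∫ ω, l1dist (X a) (μ (assigned μ (fun n => cut n ω) (X a))) ∂P
        ≤ ∑ a, 100000 * min (kFactor k) (dFactor d) * distToCenters μ (X a) := by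
          refine Finset.sum_le_sum fun a _ => ?_
          rcases min_choice (kFactor k) (dFactor d) with e | e <;> rw [e]
          · exact (point (X a)).2.1
          · exact (point (X a)).2.2
      _ = 100000 * min (kFactor k) (dFactor d) * mediansCost μ X := by
          rw [← Finset.mul_sum, mediansCost]
      _ ≤ 100000 * min (kFactor k) (dFactor d) * (A * mediansOPT k X) := by gcongr
      _ = 100000 * A * min (kFactor k) (dFactor d) * mediansOPT k X := by ring
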